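/- A (plain) multicategory has objects and morphisms $T:X_1\times\dots\times X_d\to Y$ ($d\ge 0$) with an associative and unital plugging operation $T\circ(T_1\times\dots\times T_d)$; a natural transformation $\varphi:F\to G$ of functors is a family of unary morphisms $\varphi_X:F(X)\to G(X)$ with $\varphi_Y\circ F(T)=G(T)\circ(\varphi_{X_1}\times\dots\times\varphi_{X_d})$ for all $T$. Two multicategories $M,N$ are equivalent if there are functors $F:M\to N$ and $G:N\to M$ such that $F\circ G$ and $G\circ F$ are naturally equivalent to the identity functors. For a field $k$, $\mathrm{Rep}_k(M)$ is the category of functors from $M$ to the multicategory of $k$-vector spaces and multilinear maps, whose morphisms are the intertwiners, i.e. the families of linear maps $V_X\to V'_X$ that commute with the action of every morphism of $M$. An $n$-disk is a disk with $n$ pins on its boundary, numbered anticlockwise; an $(m,n)$-box is a rectangle with $m$ pins on its lower and $n$ pins on its upper edge. A planar diagram in an outer disk (box) consists of finitely many disjoint numbered inner disks (boxes), placed in its interior in an orientation-preserving way, and of finitely many disjoint strings (arcs and closed loops) in the region outside of the inner ones, such that every pin, inner or outer, is the endpoint of exactly one string and every endpoint of a string is a pin. Diagrams are taken up to planar isotopy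 fixing the outer boundary. Let $\mathcal D_\circ$ (resp. $\mathcal D_\square$) be the multicategory whose objects are the $n$-disks, $n\ge 0$ (resp. the $(m,n)$-boxes, $m,n\ge0$), whose morphisms $X_1\times\dots\times X_d\to Y$ are the isotopy classes of planar diagrams with outer disk (box) $Y$ and inner disks (boxes) $X_1,\dots,X_d$, with composition given by inserting diagrams into the inner disks (boxes). Let $\mathcal D_\circ^{\mathrm{even}}$ and $\mathcal D_\square^{\mathrm{even}}$ be the full submulticategories on the objects with an even total number of pins, and let $\mathcal D_\triangle$ be the full submulticategory of $\mathcal D_\square^{\mathrm{even}}$ on the $(n,n)$-boxes. Proposition. The multicategories $\mathcal D_\circ$ and $\mathcal D_\square$ are equivalent. The three multicategories $\mathcal D_\circ^{\mathrm{even}}$, $\mathcal D_\square^{\mathrm{even}}$ and $\mathcal D_\triangle$ are mutually equivalent. Consequently, for every field $k$, the categories $\mathrm{Rep}_k(\mathcal D_\circ)$ and $\mathrm{Rep}_k(\mathcal D_\square)$ are equivalent, and the three categories $\mathrm{Rep}_k(\mathcal D_\circ^{\mathrm{even}})$, $\mathrm{Rep}_k(\mathcal D_\square^{\mathrm{even}})$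 and $\mathrm{Rep}_k(\mathcal D_\triangle)$ are mutually equivalent. -/

import Mathlib

open CategoryTheory

namespace PlanarDiagrams

universe u v u' v' w

/-! ### Multicategories -/

/-- Concatenation of the sequences `Z 0, Z 1, …, Z (d - 1)`; position `k` of the concatenation is
position `j` of `Z i` for `⟨i, j⟩ = finSigmaFinEquiv.symm k` (lexicographic order). -/
abbrev concat {A : Type*} {d : ℕ} {e : Fin d → ℕ} (Z : (i : Fin d) → Fin (e i) → A) :
    Fin (∑ i, e i) → A :=
  fun k => Z (finSigmaFinEquiv.symm k).1 (finSigmaFinEquiv.symm k).2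

/-- A (plain) multicategory: morphisms have a finite sequence of inputs and one output, and
`comp T U` plugs `U i` into the `i`-th input of `T`. The two sides of each axiom have inputs which
are equal sequences, but not by definition, whence the heterogeneous equalities. -/
structure Multicategory where
  Obj : Type u
  Hom : {d : ℕ} → (Fin d → Obj) → Obj → Type v
  id : (X : Obj) → Hom (fun _ : Fin 1 => X) X
  comp : {d : ℕ} → {X : Fin d → Obj} → {Y : Obj} → {e : Fin d → ℕ} →
    {Z : (i : Fin d) → Fin (e i) → Obj} →
    Hom X Y → ((i : Fin d) → Hom (Z i) (X i)) → Hom (concat Z) Y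
  id_comp : ∀ {d : ℕ} {X : Fin d → Obj} {Y : Obj} (T : Hom X Y),
    HEq (comp (id Y) (fun _ => T)) T
  comp_id : ∀ {d : ℕ} {X : Fin d → Obj} {Y : Obj} (T : Hom X Y),
    HEq (comp T (fun i => id (X i))) T
  assoc : ∀ {d : ℕ} {X : Fin d → Obj} {Y : Obj} {e : Fin d → ℕ}
    {Z : (i : Fin d) → Fin (e i) → Obj} {f : (i : Fin d) → Fin (e i) → ℕ}
    {V : (i : Fin d) → (j : Fin (e i)) → Fin (f i j) → Obj}
    (T : Hom X Y) (U : (i : Fin d) → Hom (Z i) (X i))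
    (W : (i : Fin d) → (j : Fin (e i)) → Hom (V i j) (Z i j)),
    HEq (comp (comp T U) (fun k => W (finSigmaFinEquiv.symm k).1 (finSigmaFinEquiv.symm k).2))
      (comp T (fun i => comp (U i) (W i)))

/-- The full submulticategory on the objects that satisfy `P`. -/
def Multicategory.full (M : Multicategory.{u, v}) (P : M.Obj → Prop) : Multicategory.{u, v} where
  Obj := {X : M.Obj // P X}
  Hom X Y := M.Hom (fun i => (X i).1) Y.1
  id X := M.id X.1
  comp T U := M.comp T U
  id_comp T := M.id_comp T
  comp_id T := M.comp_id T
  assoc T U W := M.assoc T U W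

/-- Functors between multicategories. -/
structure MFunctor (M : Multicategory.{u, v}) (N : Multicategory.{u', v'}) where
  obj : M.Obj → N.Obj
  map : {d : ℕ} → {X : Fin d → M.Obj} → {Y : M.Obj} →
    M.Hom X Y → N.Hom (fun i => obj (X i)) (obj Y)
  map_id : ∀ X : M.Obj, map (M.id X) = N.id (obj X)
  map_comp : ∀ {d : ℕ} {X : Fin d → M.Obj} {Y : M.Obj} {e : Fin d → ℕ}
    {Z : (i : Fin d) → Fin (e i) → M.Obj} (T : M.Hom X Y) (U : (i : Fin d) → M.Hom (Z i) (X i)),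
    map (M.comp T U) = N.comp (map T) (fun i => map (U i))

/-- The identity functor. -/
def MFunctor.id (M : Multicategory.{u, v}) : MFunctor M M where
  obj X := X
  map T := T
  map_id _ := rfl
  map_comp _ _ := rfl

/-- `F.comp G` is `F` followed by `G`. -/
def MFunctor.comp {L : Multicategory.{u, v}} {M : Multicategory.{u', v'}} {N : Multicategory}
    (F : MFunctor L M) (G : MFunctor M N) : MFunctor L N where
  obj X := G.obj (F.obj X)
  map T := G.map (F.map T)
  map_id X := by rw [F.map_id, G.map_id]
  map_comp T U := by rw [F.map_comp, G.map_comp]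

/-- Natural transformations: `φ_Y ∘ F(T) = G(T) ∘ (φ_{X_1} × … × φ_{X_d})` for all `T`. -/
structure MNatTrans {M : Multicategory.{u, v}} {N : Multicategory.{u', v'}}
    (F G : MFunctor M N) where
  app : (X : M.Obj) → N.Hom (fun _ : Fin 1 => F.obj X) (G.obj X)
  naturality : ∀ {d : ℕ} {X : Fin d → M.Obj} {Y : M.Obj} (T : M.Hom X Y),
    HEq (N.comp (app Y) (fun _ => F.map T)) (N.comp (G.map T) (fun i => app (X i)))

/-- Natural equivalences: natural transformations with an inverse. -/
structure MNatIso {M : Multicategory.{u, v}} {N : Multicategory.{u', v'}}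
    (F G : MFunctor M N) where
  hom : MNatTrans F G
  inv : MNatTrans G F
  hom_inv : ∀ X : M.Obj, HEq (N.comp (inv.app X) (fun _ => hom.app X)) (N.id (F.obj X))
  inv_hom : ∀ X : M.Obj, HEq (N.comp (hom.app X) (fun _ => inv.app X)) (N.id (G.obj X))

/-- Equivalence of multicategories. -/
def Multicategory.Equivalent (M : Multicategory.{u, v}) (N : Multicategory.{u', v'}) : Prop :=
  ∃ (F : MFunctor M N) (G : MFunctor N M),
    Nonempty (MNatIso (G.comp F) (MFunctor.id N)) ∧ Nonempty (MNatIso (F.comp G) (MFunctor.id M))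

/-! ### Bookkeeping for iterated concatenation -/

theorem finSigma_lt_iff {d : ℕ} {e : Fin d → ℕ} (i i' : Fin d) (j : Fin (e i)) (j' : Fin (e i')) :
    (finSigmaFinEquiv ⟨i, j⟩ : Fin (∑ i, e i)) < finSigmaFinEquiv ⟨i', j'⟩ ↔
      i < i' ∨ (i = i' ∧ (j : ℕ) < j') := by
  have key : ∀ (i i' : Fin d) (j : Fin (e i)) (j' : Fin (e i')), i < i' →
      (finSigmaFinEquiv ⟨i, j⟩ : Fin (∑ i, e i)) < finSigmaFinEquiv ⟨i', j'⟩ := by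
    intro i i' j j' h
    rw [Fin.lt_def, finSigmaFinEquiv_apply, finSigmaFinEquiv_apply]
    have h1 : ∀ i : Fin d, ∑ a : Fin i, e (Fin.castLE i.2.le a) =
        ∑ a ∈ Finset.univ.filter (fun a : Fin d => a < i), e a := by
      intro i
      refine Finset.sum_bij (fun a _ => Fin.castLE i.2.le a) ?_ ?_ ?_ ?_
      · intro a _
        simp only [Finset.mem_filter, Finset.mem_univ, true_and]
        exact a.2
      · intro a _ b _ hab
        simpa [Fin.ext_iff] using hab
      · intro b hb
        simp only [Finset.mem_filter, Finset.mem_univ, true_and, Fin.lt_def] at hb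
        exact ⟨⟨b, hb⟩, Finset.mem_univ _, rfl⟩
      · intro a _
        rfl
    simp only [h1]
    have h2 : insert i (Finset.univ.filter (fun a : Fin d => a < i)) ⊆
        Finset.univ.filter (fun a : Fin d => a < i') := by
      intro a ha
      simp only [Finset.mem_insert, Finset.mem_filter, Finset.mem_univ, true_and] at ha ⊢
      rcases ha with rfl | ha
      · exact h
      · exact ha.trans h
    have h3 := Finset.sum_le_sum_of_subset (f := e) h2
    rw [Finset.sum_insert (by simp)] at h3
    have := j.2
    omega
  rcases lt_trichotomy i i' with h | h | h
  · simp [h, key i i' j j' h]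
  · subst h
    rw [Fin.lt_def, finSigmaFinEquiv_apply, finSigmaFinEquiv_apply]
    simp
  · have := key i' i j' j h
    constructor
    · intro h'
      exact absurd (this.trans h') (lt_irrefl _)
    · rintro (h' | ⟨h', _⟩)
      · exact absurd (h.trans h') (lt_irrefl _)
      · exact absurd (h' ▸ h) (lt_irrefl _)

theorem val_eq_of_lt_iff {A : Type*} {m n : ℕ} (f : A ≃ Fin m) (g : A ≃ Fin n)
    (h : ∀ a b, f a < f b ↔ g a < g b) (a : A) : (f a : ℕ) = g a := by
  classical
  let _ : Fintype A := Fintype.ofEquiv _ f.symm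
  have key : ∀ {m : ℕ} (f : A ≃ Fin m), (f a : ℕ) =
      (Finset.univ.filter (fun b => f b < f a)).card := by
    intro m f
    rw [← Finset.card_map f.toEmbedding]
    have : (Finset.univ.filter (fun b => f b < f a)).map f.toEmbedding = Finset.Iio (f a) := by
      ext k
      simp only [Finset.mem_map, Finset.mem_filter, Finset.mem_univ, true_and, Finset.mem_Iio]
      constructor
      · rintro ⟨b, hb, rfl⟩
        exact hb
      · intro hk
        exact ⟨f.symm k, by simpa using hk, by simp⟩
    rw [this, Fin.card_Iio]
  rw [key f, key g]
  simp only [h]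

/-- Concatenating in two steps or at once gives the same positions. -/
theorem finSigma_assoc {d : ℕ} {e : Fin d → ℕ} {f : (i : Fin d) → Fin (e i) → ℕ}
    (k : Fin (∑ i, e i))
    (l : Fin (f (finSigmaFinEquiv.symm k).1 (finSigmaFinEquiv.symm k).2)) :
    ((finSigmaFinEquiv ⟨k, l⟩ : Fin (∑ k, concat f k)) : ℕ) =
      (finSigmaFinEquiv ⟨(finSigmaFinEquiv.symm k).1,
        finSigmaFinEquiv ⟨(finSigmaFinEquiv.symm k).2, l⟩⟩ : Fin (∑ i, ∑ j, f i j)) := by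
  let A := (k : Fin (∑ i, e i)) × Fin (concat f k)
  let g : A ≃ Fin (∑ i, ∑ j, f i j) :=
    ((finSigmaFinEquiv (n := e)).symm.sigmaCongrLeft
      (β := fun p : (i : Fin d) × Fin (e i) => Fin (f p.1 p.2))).trans
      ((Equiv.sigmaAssoc (fun i j => Fin (f i j))).trans
        ((Equiv.sigmaCongrRight (fun i => finSigmaFinEquiv (n := f i))).trans finSigmaFinEquiv))
  have hg : ∀ a : A, g a = finSigmaFinEquiv ⟨(finSigmaFinEquiv.symm a.1).1,
      finSigmaFinEquiv ⟨(finSigmaFinEquiv.symm a.1).2, a.2⟩⟩ := fun a => rfl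
  have aux : ∀ (p p' : (i : Fin d) × Fin (e i)) (l : Fin (f p.1 p.2)) (l' : Fin (f p'.1 p'.2)),
      (p.1 < p'.1 ∨ p.1 = p'.1 ∧ (p.2 : ℕ) < p'.2) ∨ p = p' ∧ (l : ℕ) < l' ↔
      p.1 < p'.1 ∨ p.1 = p'.1 ∧ ((finSigmaFinEquiv ⟨p.2, l⟩ : Fin (∑ j, f p.1 j)) : ℕ) <
        (finSigmaFinEquiv ⟨p'.2, l'⟩ : Fin (∑ j, f p'.1 j)) := by
    rintro ⟨i, j⟩ ⟨i', j'⟩ l l'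
    dsimp only at l l' ⊢
    by_cases hi : i = i'
    · subst hi
      by_cases hj : j = j'
      · subst hj
        simp [finSigma_lt_iff, -finSigmaFinEquiv_apply]
      · simp [hj, finSigma_lt_iff, -finSigmaFinEquiv_apply]
    · simp [hi]
  have := val_eq_of_lt_iff (A := A) finSigmaFinEquiv g ?_ ⟨k, l⟩
  · rw [this, hg]
  · rintro ⟨k, l⟩ ⟨k', l'⟩
    rw [hg, hg, finSigma_lt_iff, finSigma_lt_iff]
    have h1 := finSigma_lt_iff (e := e) (finSigmaFinEquiv.symm k).1 (finSigmaFinEquiv.symm k').1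
      (finSigmaFinEquiv.symm k).2 (finSigmaFinEquiv.symm k').2
    simp only [Sigma.eta, Equiv.apply_symm_apply] at h1
    have h2 : k = k' ↔ finSigmaFinEquiv.symm k = finSigmaFinEquiv.symm k' := by simp
    rw [h1, h2]
    exact aux _ _ l l'

theorem finSigma_assoc_card {d : ℕ} {e : Fin d → ℕ} (f : (i : Fin d) → Fin (e i) → ℕ) :
    ∑ k, concat f k = ∑ i, ∑ j, f i j := by
  rw [← finSigmaFinEquiv.sum_comp, Fintype.sum_sigma]
  refine Finset.sum_congr rfl fun i _ => Finset.sum_congr rfl fun j _ => ?_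
  simp only [concat]
  rw [Equiv.symm_apply_apply]

theorem finSigma_one (d : ℕ) (i : Fin d) :
    ((finSigmaFinEquiv ⟨i, 0⟩ : Fin (∑ _ : Fin d, 1)) : ℕ) = i := by
  simp [finSigmaFinEquiv_apply]

/-! ### The multicategory of vector spaces, and representations -/

section MRep

variable (k : Type u) [Field k]

theorem multilinear_heq {d d' : ℕ} {X : Fin d → ModuleCat.{w} k} {X' : Fin d' → ModuleCat.{w} k}
    {Y : ModuleCat.{w} k} (hd : d = d') (hX : ∀ i, X i = X' (Fin.cast hd i))
    (T : MultilinearMap k (fun i => X i) Y) (T' : MultilinearMap k (fun i => X' i) Y)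
    (h : ∀ (x : ∀ i, X i) (x' : ∀ i, X' i), (∀ i, HEq (x i) (x' (Fin.cast hd i))) → T x = T' x') :
    HEq T T' := by
  subst hd
  obtain rfl : X = X' := funext hX
  exact heq_of_eq (MultilinearMap.ext fun x => h x x fun _ => HEq.rfl)

theorem piCongrLeft'_symm_heq {α β : Type*} {P : α → Type*} (σ : α ≃ β)
    (x : (b : β) → P (σ.symm b)) (a : α) : HEq ((σ.piCongrLeft' P).symm x a) (x (σ a)) := by
  obtain ⟨b, rfl⟩ := σ.symm.surjective a
  rw [Equiv.piCongrLeft'_symm_apply_apply, Equiv.apply_symm_apply]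

theorem sigma_heq {A : Type*} {B : A → Type*} {P : (a : A) → B a → Type*} (g : ∀ a b, P a b)
    {a : A} {b : B a} {p : (a : A) × B a} (h : p = ⟨a, b⟩) : HEq (g a b) (g p.1 p.2) := by
  subst h
  rfl

variable {k} in
/-- Composition of multilinear maps. -/
def multilinearComp {d : ℕ} {X : Fin d → ModuleCat.{w} k} {Y : ModuleCat.{w} k} {e : Fin d → ℕ}
    {Z : (i : Fin d) → Fin (e i) → ModuleCat.{w} k} (T : MultilinearMap k (fun i => X i) Y)
    (U : (i : Fin d) → MultilinearMap k (fun j => Z i j) (X i)) :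
    MultilinearMap k (fun l => (concat Z l : ModuleCat.{w} k)) Y :=
  MultilinearMap.domDomCongrLinearEquiv' k k (fun p : (i : Fin d) × Fin (e i) => Z p.1 p.2) Y
    finSigmaFinEquiv (T.compMultilinearMap U)

variable {k} in
theorem multilinearComp_apply {d : ℕ} {X : Fin d → ModuleCat.{w} k} {Y : ModuleCat.{w} k}
    {e : Fin d → ℕ} {Z : (i : Fin d) → Fin (e i) → ModuleCat.{w} k}
    (T : MultilinearMap k (fun i => X i) Y)
    (U : (i : Fin d) → MultilinearMap k (fun j => Z i j) (X i)) (x : ∀ l, (concat Z l : ModuleCat.{w} k))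
    (y : ∀ i j, Z i j) (h : ∀ i j, HEq (y i j) (x (finSigmaFinEquiv ⟨i, j⟩))) :
    multilinearComp T U x = T (fun i => U i (y i)) := by
  change T (fun i => U i (fun j => (finSigmaFinEquiv.piCongrLeft'
    (fun p : (i : Fin d) × Fin (e i) => Z p.1 p.2)).symm x ⟨i, j⟩)) = _
  congr 1
  funext i
  congr 1
  funext j
  exact eq_of_heq ((piCongrLeft'_symm_heq
    (P := fun p : (i : Fin d) × Fin (e i) => (Z p.1 p.2 : Type w)) finSigmaFinEquiv x ⟨i, j⟩).trans (h i j).symm)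

/-- The multicategory of vector spaces over `k` and multilinear maps. -/
def MVec : Multicategory where
  Obj := ModuleCat.{w} k
  Hom X Y := MultilinearMap k (fun i => X i) Y
  id X := MultilinearMap.ofSubsingleton k X X (0 : Fin 1) LinearMap.id
  comp T U := multilinearComp T U
  id_comp {d X Y} T := by
    have hv : ∀ j : Fin d, (finSigmaFinEquiv ⟨0, j⟩ : Fin (∑ _ : Fin 1, d)) =
        Fin.cast (by simp) j := fun j => Fin.ext (by rw [finSigmaFinEquiv_one]; rfl)
    have hs : ∀ l : Fin (∑ _ : Fin 1, d),
        (finSigmaFinEquiv.symm l).2 = Fin.cast (by simp) l := by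
      intro l
      obtain ⟨⟨i, j⟩, rfl⟩ := finSigmaFinEquiv.surjective l
      rw [Equiv.symm_apply_apply]
      exact Fin.ext (finSigmaFinEquiv_one _).symm
    refine multilinear_heq k (by simp) (fun l => congrArg X (hs l)) _ _ ?_
    intro x x' h
    rw [multilinearComp_apply _ _ x (fun _ j => x' j) ?_]
    · rfl
    · intro i j
      obtain rfl : i = 0 := Subsingleton.elim _ _
      refine HEq.trans ?_ (h _).symm
      rw [hv]
      rfl
  comp_id {d X Y} T := by
    have hs : ∀ l : Fin (∑ _ : Fin d, 1),
        (finSigmaFinEquiv.symm l).1 = Fin.cast (by simp) l := by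
      intro l
      obtain ⟨⟨i, j⟩, rfl⟩ := finSigmaFinEquiv.surjective l
      rw [Equiv.symm_apply_apply]
      obtain rfl : j = 0 := Subsingleton.elim _ _
      exact Fin.ext (finSigma_one d i).symm
    refine multilinear_heq k (by simp) (fun l => congrArg X (hs l)) _ _ ?_
    intro x x' h
    rw [multilinearComp_apply _ _ x (fun i _ => x' i) ?_]
    · rfl
    · intro i j
      obtain rfl : j = 0 := Subsingleton.elim _ _
      have : Fin.cast (by simp) (finSigmaFinEquiv ⟨i, 0⟩ : Fin (∑ _ : Fin d, 1)) = i :=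
        Fin.ext (finSigma_one d i)
      refine HEq.trans ?_ (h _).symm
      rw [this]
  assoc {d X Y e Z f V} T U W := by
    have hs : ∀ n : Fin (∑ k, concat f k), ∀ n' : Fin (∑ i, ∑ j, f i j), (n : ℕ) = n' →
        concat (fun k => V (finSigmaFinEquiv.symm k).1 (finSigmaFinEquiv.symm k).2) n =
        concat (fun i => concat (V i)) n' := by
      intro n n' h
      obtain ⟨⟨k, l⟩, rfl⟩ := finSigmaFinEquiv.surjective n
      obtain rfl := Fin.ext (h.symm.trans (finSigma_assoc k l))
      simp only [concat]
      rw [Equiv.symm_apply_apply, Equiv.symm_apply_apply, Equiv.symm_apply_apply]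
    refine multilinear_heq k (finSigma_assoc_card f) (fun l => hs _ _ rfl) _ _ ?_
    intro x x' h
    have hx : ∀ i j l, ∃ y : V i j l, HEq y (x' (finSigmaFinEquiv ⟨i, finSigmaFinEquiv ⟨j, l⟩⟩)) := by
      intro i j l
      refine ⟨cast ?_ (x' (finSigmaFinEquiv ⟨i, finSigmaFinEquiv ⟨j, l⟩⟩)), cast_heq _ _⟩
      simp only [concat]
      rw [Equiv.symm_apply_apply, Equiv.symm_apply_apply]
    choose y hy using hx
    have hy2 : ∀ i, ∃ y2 : ∀ m, (concat (V i) m : ModuleCat.{w} k), ∀ j l, HEq (y i j l) (y2 (finSigmaFinEquiv ⟨j, l⟩)) := by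
      intro i
      refine ⟨fun m => y i (finSigmaFinEquiv.symm m).1 (finSigmaFinEquiv.symm m).2, ?_⟩
      intro j l
      exact sigma_heq (y i) (Equiv.symm_apply_apply _ _)
    choose y2 hy2 using hy2
    rw [multilinearComp_apply (Z := fun k => V (finSigmaFinEquiv.symm k).1 (finSigmaFinEquiv.symm k).2)
      _ _ x (fun k l => y _ _ l) ?_]
    · rw [multilinearComp_apply _ _ _ (fun i j => W i j (y i j)) ?_]
      · rw [multilinearComp_apply _ _ x' y2 ?_]
        · congr 1
          funext i
          rw [multilinearComp_apply _ _ _ (y i) (hy2 i)]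
        · intro i m
          obtain ⟨⟨j, l⟩, rfl⟩ := finSigmaFinEquiv.surjective m
          exact (hy2 i j l).symm.trans (hy i j l)
      · intro i j
        exact sigma_heq (fun i j => W i j (y i j)) (Equiv.symm_apply_apply _ _)
    · intro n l
      refine (hy _ _ _).trans (HEq.trans ?_ (h _).symm)
      have : (finSigmaFinEquiv ⟨(finSigmaFinEquiv.symm n).1,
        finSigmaFinEquiv ⟨(finSigmaFinEquiv.symm n).2, l⟩⟩ : Fin (∑ i, ∑ j, f i j)) =
        Fin.cast (finSigma_assoc_card f) (finSigmaFinEquiv ⟨n, l⟩) :=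
        Fin.ext (finSigma_assoc n l).symm
      rw [this]

/-- Linear representations of a multicategory over `k`. -/
def MRep (M : Multicategory.{u', v'}) := MFunctor M (MVec.{u, w} k)

variable {k}

/-- The vector space `V_X` of a representation. -/
def MRep.space {M : Multicategory.{u', v'}} (V : MRep.{u, u', v', w} k M) (X : M.Obj) :
    ModuleCat.{w} k := V.obj X

/-- The multilinear map `π_T : V_{X_1} × … × V_{X_d} → V_Y` of a representation. -/
def MRep.act {M : Multicategory.{u', v'}} (V : MRep.{u, u', v', w} k M) {d : ℕ} {X : Fin d → M.Obj}
    {Y : M.Obj} (T : M.Hom X Y) : MultilinearMap k (fun i => V.space (X i)) (V.space Y) := V.map T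

/-- Intertwiners: families of linear maps that commute with the action of all morphisms. -/
@[ext]
structure Intertwiner {M : Multicategory.{u', v'}} (V V' : MRep.{u, u', v', w} k M) where
  app : (X : M.Obj) → V.space X →ₗ[k] V'.space X
  comm : ∀ {d : ℕ} {X : Fin d → M.Obj} {Y : M.Obj} (T : M.Hom X Y) (x : ∀ i, V.space (X i)),
    app Y (V.act T x) = V'.act T (fun i => app (X i) (x i))

/-- The category of representations and intertwiners. -/
instance (M : Multicategory.{u', v'}) : Category (MRep.{u, u', v', w} k M) where
  Hom V V' := Intertwiner V V'
  id V := { app := fun X => LinearMap.id, comm := fun _ _ => rfl }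
  comp φ ψ :=
    { app := fun X => (ψ.app X).comp (φ.app X)
      comm := fun T x => by simp [φ.comm, ψ.comm] }

end MRep

end PlanarDiagrams

namespace PlanarDiagrams

open Set Filter
open scoped Topology unitInterval

/-! ### Isotopies of the plane -/

/-- An isotopy of the plane `ℂ` that starts at the identity: a level-preserving homeomorphism of
`[0, 1] × ℂ` that is the identity at time `0`. -/
structure PlaneIsotopy where
  toHomeo : (I × ℂ) ≃ₜ (I × ℂ)
  fst_eq : ∀ x, (toHomeo x).1 = x.1
  start : ∀ z, toHomeo (0, z) = (0, z)

namespace PlaneIsotopy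

/-- The position at time `t` of the point that starts at `z`. -/
noncomputable def eval (H : PlaneIsotopy) (t : I) (z : ℂ) : ℂ := (H.toHomeo (t, z)).2

theorem toHomeo_eq (H : PlaneIsotopy) (t : I) (z : ℂ) : H.toHomeo (t, z) = (t, H.eval t z) :=
  Prod.ext (H.fst_eq _) rfl

theorem symm_fst (H : PlaneIsotopy) (x : I × ℂ) : (H.toHomeo.symm x).1 = x.1 := by
  have := H.fst_eq (H.toHomeo.symm x)
  rw [Homeomorph.apply_symm_apply] at this
  exact this.symm

/-- The constant isotopy. -/
noncomputable def refl : PlaneIsotopy where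
  toHomeo := Homeomorph.refl _
  fst_eq _ := rfl
  start _ := rfl

/-- The inverse isotopy. -/
noncomputable def symm (H : PlaneIsotopy) : PlaneIsotopy where
  toHomeo := H.toHomeo.symm
  fst_eq := H.symm_fst
  start z := by rw [Homeomorph.symm_apply_eq, H.start]

/-- First `H`, then `G`, at each time. -/
noncomputable def trans (H G : PlaneIsotopy) : PlaneIsotopy where
  toHomeo := H.toHomeo.trans G.toHomeo
  fst_eq x := by simp [G.fst_eq, H.fst_eq]
  start z := by simp [H.start, G.start]

/-- The isotopy `H` seen through a homeomorphism `φ` of the plane. -/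
noncomputable def conj (H : PlaneIsotopy) (φ : ℂ ≃ₜ ℂ) : PlaneIsotopy where
  toHomeo := (((Homeomorph.refl I).prodCongr φ.symm).trans H.toHomeo).trans
    ((Homeomorph.refl I).prodCongr φ)
  fst_eq x := by simp [H.fst_eq]
  start z := by simp [H.start]

theorem eval_refl (t : I) (z : ℂ) : refl.eval t z = z := rfl

theorem eval_trans (H G : PlaneIsotopy) (t : I) (z : ℂ) :
    (H.trans G).eval t z = G.eval t (H.eval t z) := by
  change (G.toHomeo (H.toHomeo (t, z))).2 = _
  rw [H.toHomeo_eq]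
  rfl

theorem eval_symm_eval (H : PlaneIsotopy) (t : I) (z : ℂ) : H.symm.eval t (H.eval t z) = z := by
  change (H.toHomeo.symm (t, H.eval t z)).2 = z
  rw [← H.toHomeo_eq, Homeomorph.symm_apply_apply]

theorem eval_eval_symm (H : PlaneIsotopy) (t : I) (z : ℂ) : H.eval t (H.symm.eval t z) = z :=
  H.symm.eval_symm_eval t z

theorem eval_injective (H : PlaneIsotopy) (t : I) : Function.Injective (H.eval t) :=
  Function.LeftInverse.injective (H.eval_symm_eval t)

theorem eval_surjective (H : PlaneIsotopy) (t : I) : Function.Surjective (H.eval t) :=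
  Function.RightInverse.surjective (H.eval_eval_symm t)

theorem eval_conj (H : PlaneIsotopy) (φ : ℂ ≃ₜ ℂ) (t : I) (z : ℂ) :
    (H.conj φ).eval t (φ z) = φ (H.eval t z) := by
  change φ (H.toHomeo (t, φ.symm (φ z))).2 = _
  rw [φ.symm_apply_apply]
  rfl

theorem eval_mem (H : PlaneIsotopy) {t : I} {B : Set ℂ} (h : ∀ z, z ∉ B → H.eval t z = z) {z : ℂ}
    (hz : z ∈ B) : H.eval t z ∈ B := by
  by_contra h'
  have := H.eval_injective t (h _ h')
  exact h' (this.symm ▸ hz)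

theorem image_eq_of_iff (H : PlaneIsotopy) {t : I} {S S' : Set ℂ}
    (h : ∀ z, z ∈ S ↔ H.eval t z ∈ S') : H.eval t '' S = S' := by
  ext w
  obtain ⟨z, rfl⟩ := H.eval_surjective t w
  rw [(H.eval_injective t).mem_set_image, h]

/-- Isotopies supported in disjoint sets can be performed simultaneously. -/
theorem exists_glue {ι : Type*} [Finite ι] (φ : ι → ℂ ≃ₜ ℂ) (B : ι → Set ℂ)
    (hB : ∀ i j, i ≠ j → Disjoint (φ i '' B i) (φ j '' B j)) (G : ι → PlaneIsotopy)
    (hG : ∀ i t z, z ∉ B i → (G i).eval t z = z) :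
    ∃ K : PlaneIsotopy, (∀ i t z, z ∈ B i → K.eval t (φ i z) = φ i ((G i).eval t z)) ∧
      ∀ t z, (∀ i, z ∉ φ i '' B i) → K.eval t z = z := by
  classical
  have := Fintype.ofFinite ι
  suffices h : ∀ s : Finset ι, ∃ K : PlaneIsotopy,
      (∀ i ∈ s, ∀ t z, z ∈ B i → K.eval t (φ i z) = φ i ((G i).eval t z)) ∧
      ∀ t z, (∀ i ∈ s, z ∉ φ i '' B i) → K.eval t z = z by
    obtain ⟨K, h1, h2⟩ := h Finset.univ
    exact ⟨K, fun i => h1 i (Finset.mem_univ i), fun t z hz => h2 t z fun i _ => hz i⟩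
  intro s
  induction s using Finset.induction_on with
  | empty => exact ⟨refl, by simp, fun _ _ _ => rfl⟩
  | insert j s hj ih =>
    obtain ⟨K, h1, h2⟩ := ih
    have hout : ∀ t z, z ∉ φ j '' B j → ((G j).conj (φ j)).eval t z = z := by
      intro t z hz
      obtain ⟨x, rfl⟩ := (φ j).surjective z
      rw [eval_conj, hG]
      exact fun hx => hz ⟨x, hx, rfl⟩
    refine ⟨K.trans ((G j).conj (φ j)), ?_, ?_⟩
    · intro i hi t z hz
      rw [eval_trans]
      rcases Finset.mem_insert.1 hi with rfl | hi
      · rw [h2, eval_conj]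
        intro k hk hzk
        exact disjoint_left.1 (hB i k (fun h => hj (h ▸ hk))) ⟨z, hz, rfl⟩ hzk
      · rw [h1 i hi t z hz, hout]
        intro hzj
        exact disjoint_left.1 (hB i j (fun h => hj (h ▸ hi)))
          ⟨_, (G i).eval_mem (hG i t) hz, rfl⟩ hzj
    · intro t z hz
      rw [eval_trans, h2 t z fun i hi => hz i (Finset.mem_insert_of_mem hi),
        hout t z (hz j (Finset.mem_insert_self _ _))]

end PlaneIsotopy

/-- Homeomorphisms of the plane that are isotopic to the identity, that is, the
orientation-preserving ones. -/
def IsotopicToId (φ : ℂ ≃ₜ ℂ) : Prop := ∃ H : PlaneIsotopy, ∀ z, H.eval 1 z = φ z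

theorem IsotopicToId.trans {φ ψ : ℂ ≃ₜ ℂ} (hφ : IsotopicToId φ) (hψ : IsotopicToId ψ) :
    IsotopicToId (φ.trans ψ) := by
  obtain ⟨H, hH⟩ := hφ
  obtain ⟨G, hG⟩ := hψ
  exact ⟨H.trans G, fun z => by rw [PlaneIsotopy.eval_trans, hH, hG]; rfl⟩

/-! ### Bodies with pins -/

/-- A closed topological disk `{z | gauge z ≤ 1}` around the origin of the plane, star-shaped
about the origin, with finitely many pins on its boundary `{z | gauge z = 1}`. -/
structure PinnedBody where
  gauge : ℂ → ℝ
  continuous_gauge : Continuous gauge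
  gauge_smul : ∀ (t : ℝ) (z : ℂ), 0 ≤ t → gauge (t • z) = t * gauge z
  gauge_pos : ∀ z, z ≠ 0 → 0 < gauge z
  Pin : Type
  finite_pin : Finite Pin
  pin : Pin → ℂ
  pin_injective : Function.Injective pin
  gauge_pin : ∀ p, gauge (pin p) = 1

namespace PinnedBody

/-- The closed region itself. -/
def body (X : PinnedBody) : Set ℂ := {z | X.gauge z ≤ 1}

/-- The union of the open rays that start at the origin and pass through the pins. -/
def spokes (X : PinnedBody) : Set ℂ := {z | ∃ (p : X.Pin) (t : ℝ), 0 < t ∧ z = t • X.pin p}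

variable (X : PinnedBody)

theorem gauge_zero : X.gauge 0 = 0 := by simpa using X.gauge_smul 0 0 le_rfl

theorem gauge_nonneg (z : ℂ) : 0 ≤ X.gauge z := by
  by_cases h : z = 0
  · rw [h, X.gauge_zero]
  · exact (X.gauge_pos z h).le

theorem smul_mem_spokes {t : ℝ} (ht : 0 < t) (z : ℂ) : t • z ∈ X.spokes ↔ z ∈ X.spokes := by
  constructor
  · rintro ⟨p, s, hs, h⟩
    refine ⟨p, t⁻¹ * s, by positivity, ?_⟩
    rw [mul_smul, ← h, smul_smul, inv_mul_cancel₀ ht.ne', one_smul]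
  · rintro ⟨p, s, hs, rfl⟩
    exact ⟨p, t * s, by positivity, by rw [mul_smul]⟩

theorem isClosed_le (c : ℝ) : IsClosed {z | X.gauge z ≤ c} :=
  _root_.isClosed_le X.continuous_gauge continuous_const

theorem isCompact_le (c : ℝ) : IsCompact {z | X.gauge z ≤ c} := by
  obtain ⟨w, hw, hmin⟩ := (isCompact_sphere (0 : ℂ) 1).exists_isMinOn
    ⟨1, by simp⟩ X.continuous_gauge.continuousOn
  have hw0 : 0 < X.gauge w := X.gauge_pos w (by rintro rfl; simp at hw)
  refine (isCompact_closedBall (0 : ℂ) (c / X.gauge w)).of_isClosed_subset (X.isClosed_le c) ?_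
  intro z hz
  rw [mem_closedBall_zero_iff, le_div_iff₀ hw0]
  refine le_trans ?_ hz
  by_cases h : z = 0
  · simp [h, X.gauge_zero]
  · have hn : 0 < ‖z‖ := norm_pos_iff.2 h
    have h1 : z = ‖z‖ • (‖z‖⁻¹ • z) := by
      rw [smul_smul, mul_inv_cancel₀ hn.ne', one_smul]
    have h2 : X.gauge w ≤ X.gauge (‖z‖⁻¹ • z) := hmin (by
      rw [mem_sphere_zero_iff_norm, norm_smul, norm_inv, norm_norm, inv_mul_cancel₀ hn.ne'])
    calc ‖z‖ * X.gauge w ≤ ‖z‖ * X.gauge (‖z‖⁻¹ • z) := by gcongr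
      _ = X.gauge z := by rw [← X.gauge_smul _ _ hn.le, ← h1]

theorem exists_enlarge {O : Set ℂ} (hO : IsOpen O) (h : X.body ⊆ O) :
    ∃ c > 1, {z | X.gauge z ≤ c} ⊆ O := by
  have hK : IsCompact ({z | X.gauge z ≤ 2} \ O) := (X.isCompact_le 2).diff hO
  rcases ({z | X.gauge z ≤ 2} \ O).eq_empty_or_nonempty with h0 | h0
  · exact ⟨2, by norm_num, sdiff_eq_empty.1 h0⟩
  · obtain ⟨w, hw, hmin⟩ := hK.exists_isMinOn h0 X.continuous_gauge.continuousOn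
    have hw1 : 1 < X.gauge w := by
      by_contra h'
      exact hw.2 (h (not_lt.1 h'))
    refine ⟨(1 + X.gauge w) / 2, by linarith, ?_⟩
    intro z hz
    by_contra hzO
    have hw2 : X.gauge w ≤ 2 := hw.1
    have hz' : X.gauge z ≤ (1 + X.gauge w) / 2 := hz
    have hmem : z ∈ {z | X.gauge z ≤ 2} \ O := ⟨show X.gauge z ≤ 2 by linarith, hzO⟩
    have : X.gauge w ≤ X.gauge z := hmin hmem
    linarith

/-! ### Radial isotopies -/

/-- The factor by which a point of gauge `s` is moved by the piecewise linear map of radii that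
sends `0`, `a`, `c` to `0`, `b`, `c` and is the identity beyond `c`. -/
noncomputable def radialFactor (a b c s : ℝ) : ℝ :=
  ((c - b) + c * (b - a) / max a (min s c)) / (c - a)

theorem radialFactor_inner {a b c s : ℝ} (ha : 0 < a) (hac : a < c) (h : s ≤ a) :
    radialFactor a b c s = b / a := by
  have h1 : max a (min s c) = a := max_eq_left ((min_le_left _ _).trans h)
  have : c - a ≠ 0 := by linarith
  rw [radialFactor, h1]
  field_simp
  ring

theorem radialFactor_outer {a b c s : ℝ} (ha : 0 < a) (hac : a < c) (h : c ≤ s) :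
    radialFactor a b c s = 1 := by
  have h1 : max a (min s c) = c := by rw [min_eq_right h, max_eq_right hac.le]
  have : c - a ≠ 0 := by linarith
  have : c ≠ 0 := by linarith
  rw [radialFactor, h1]
  field_simp
  ring

theorem radialFactor_mid {a b c s : ℝ} (ha : 0 < a) (hac : a < c) (h : a ≤ s) (h' : s ≤ c) :
    radialFactor a b c s * s = ((c - b) * s + c * (b - a)) / (c - a) := by
  have h1 : max a (min s c) = s := by rw [min_eq_left h', max_eq_right h]
  have : c - a ≠ 0 := by linarith
  have : s ≠ 0 := by linarith
  rw [radialFactor, h1]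
  field_simp

theorem radialFactor_mid_mem {a b c s : ℝ} (ha : 0 < a) (hac : a < c) (hbc : b < c)
    (h : a ≤ s) (h' : s ≤ c) :
    b ≤ radialFactor a b c s * s ∧ radialFactor a b c s * s ≤ c := by
  rw [radialFactor_mid ha hac h h', le_div_iff₀ (by linarith), div_le_iff₀ (by linarith)]
  constructor <;> nlinarith

theorem radialFactor_pos {a b c s : ℝ} (ha : 0 < a) (hac : a < c) (hb : 0 < b) (hbc : b < c) :
    0 < radialFactor a b c s := by
  rcases le_total s a with h | h
  · rw [radialFactor_inner ha hac h]
    positivity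
  · rcases le_total s c with h' | h'
    · have := (radialFactor_mid_mem ha hac hbc h h').1
      have hs : 0 < s := by linarith
      by_contra h0
      have := mul_nonpos_of_nonpos_of_nonneg (not_lt.1 h0) hs.le
      linarith
    · rw [radialFactor_outer ha hac h']
      exact one_pos

theorem radialFactor_inv {a b c s : ℝ} (ha : 0 < a) (hac : a < c) (hb : 0 < b) (hbc : b < c) :
    radialFactor b a c (radialFactor a b c s * s) * radialFactor a b c s = 1 := by
  rcases le_total s a with h | h
  · rw [radialFactor_inner ha hac h, radialFactor_inner hb hbc]
    · field_simp
    · rw [div_mul_eq_mul_div, div_le_iff₀ ha]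
      nlinarith
  · rcases le_total s c with h' | h'
    · have hm := radialFactor_mid_mem ha hac hbc h h'
      have hs : s ≠ 0 := by linarith
      refine mul_right_cancel₀ hs ?_
      rw [mul_assoc, radialFactor_mid hb hbc hm.1 hm.2, radialFactor_mid ha hac h h']
      have : c - a ≠ 0 := by linarith
      have : c - b ≠ 0 := by linarith
      field_simp
      ring
    · rw [radialFactor_outer ha hac h', one_mul, radialFactor_outer hb hbc h', one_mul]

/-- The time-dependent inner radius `b / (1 + t)`. -/
theorem inner_radius {b c : ℝ} (hb : 0 < b) (hbc : b < c) (t : I) :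
    0 < b / (1 + (t : ℝ)) ∧ b / (1 + (t : ℝ)) < c := by
  have ht : 0 ≤ (t : ℝ) := t.2.1
  refine ⟨by positivity, lt_of_le_of_lt ?_ hbc⟩
  rw [div_le_iff₀ (by linarith)]
  nlinarith

/-- An isotopy which moves points radially, is the identity where the gauge is at least `c`, and
finally multiplies by `2` where the gauge is at most `b / 2`. -/
noncomputable def radial {b c : ℝ} (hb : 0 < b) (hbc : b < c) : PlaneIsotopy where
  toHomeo :=
    { toFun := fun x => (x.1, radialFactor (b / (1 + (x.1 : ℝ))) b c (X.gauge x.2) • x.2)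
      invFun := fun x => (x.1, radialFactor b (b / (1 + (x.1 : ℝ))) c (X.gauge x.2) • x.2)
      left_inv := by
        rintro ⟨t, z⟩
        obtain ⟨h1, h2⟩ := inner_radius hb hbc t
        dsimp only
        rw [X.gauge_smul _ _ (radialFactor_pos h1 h2 hb hbc).le, smul_smul,
          radialFactor_inv h1 h2 hb hbc, one_smul]
      right_inv := by
        rintro ⟨t, z⟩
        obtain ⟨h1, h2⟩ := inner_radius hb hbc t
        dsimp only
        rw [X.gauge_smul _ _ (radialFactor_pos hb hbc h1 h2).le, smul_smul,
          radialFactor_inv hb hbc h1 h2, one_smul]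
      continuous_toFun := by
        have h0 : ∀ x : I × ℂ, (1 + (x.1 : ℝ)) ≠ 0 := fun x => by
          have := x.1.2.1
          positivity
        have h1 : ∀ x : I × ℂ, max (b / (1 + (x.1 : ℝ))) (min (X.gauge x.2) c) ≠ 0 :=
          fun x => (lt_max_of_lt_left (inner_radius hb hbc x.1).1).ne'
        have h2 : ∀ x : I × ℂ, c - b / (1 + (x.1 : ℝ)) ≠ 0 := fun x => by
          have := (inner_radius hb hbc x.1).2
          linarith
        have hg := X.continuous_gauge
        unfold radialFactor
        fun_prop (disch := assumption)
      continuous_invFun := by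
        have h0 : ∀ x : I × ℂ, (1 + (x.1 : ℝ)) ≠ 0 := fun x => by
          have := x.1.2.1
          positivity
        have h1 : ∀ x : I × ℂ, max b (min (X.gauge x.2) c) ≠ 0 :=
          fun x => (lt_max_of_lt_left hb).ne'
        have hg := X.continuous_gauge
        unfold radialFactor
        fun_prop (disch := assumption) }
  fst_eq x := rfl
  start z := by
    change ((0 : I), radialFactor (b / (1 + ((0 : I) : ℝ))) b c (X.gauge z) • z) = (0, z)
    have : radialFactor (b / (1 + ((0 : I) : ℝ))) b c (X.gauge z) = 1 := by
      have : c - b ≠ 0 := by linarith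
      simp [radialFactor, this]
    rw [this, one_smul]

section

variable {b c : ℝ} (hb : 0 < b) (hbc : b < c)

theorem radial_eval (t : I) (z : ℂ) :
    (X.radial hb hbc).eval t z = radialFactor (b / (1 + (t : ℝ))) b c (X.gauge z) • z := rfl

theorem radial_outer (t : I) {z : ℂ} (h : c ≤ X.gauge z) : (X.radial hb hbc).eval t z = z := by
  obtain ⟨h1, h2⟩ := inner_radius hb hbc t
  rw [radial_eval, radialFactor_outer h1 h2 h, one_smul]

theorem radial_inner {z : ℂ} (h : X.gauge z ≤ b / 2) :
    (X.radial hb hbc).eval 1 z = (2 : ℝ) • z := by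
  obtain ⟨h1, h2⟩ := inner_radius hb hbc 1
  have h3 : (1 + ((1 : I) : ℝ)) = 2 := by norm_num
  rw [h3] at h1 h2
  rw [radial_eval, h3, radialFactor_inner h1 h2 h]
  congr 1
  field_simp

theorem radial_mem_spokes (t : I) (z : ℂ) :
    (X.radial hb hbc).eval t z ∈ X.spokes ↔ z ∈ X.spokes := by
  obtain ⟨h1, h2⟩ := inner_radius hb hbc t
  exact X.smul_mem_spokes (radialFactor_pos h1 h2 hb hbc) z

theorem radial_mid {z : ℂ} (h : b / 2 ≤ X.gauge z) (h' : X.gauge z ≤ c) :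
    b ≤ X.gauge ((X.radial hb hbc).eval 1 z) ∧ X.gauge ((X.radial hb hbc).eval 1 z) ≤ c := by
  obtain ⟨h1, h2⟩ := inner_radius hb hbc 1
  rw [radial_eval, X.gauge_smul _ _ (radialFactor_pos h1 h2 hb hbc).le]
  have h3 : (1 + ((1 : I) : ℝ)) = 2 := by norm_num
  rw [h3] at h1 h2 ⊢
  exact radialFactor_mid_mem h1 h2 hbc h h'

end

end PinnedBody

/-! ### Planar diagrams -/

/-- Some arc in `S` with `z` in its interior is a neighbourhood of `z` in `S`. -/
def LocalArc (S : Set ℂ) (z : ℂ) : Prop :=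
  ∃ γ : ℝ → ℂ, ContinuousOn γ (Icc (-1) 1) ∧ InjOn γ (Icc (-1) 1) ∧ γ 0 = z ∧
    γ '' Icc (-1) 1 ⊆ S ∧ γ '' Icc (-1) 1 ∈ 𝓝[S] z

/-- A planar diagram with inner bodies `X i` and outer body `Y`. The `i`-th inner body is embedded
in the interior of `Y` by an orientation-preserving homeomorphism of the plane, so that its pins
remain numbered in the same cyclic order; the embedded bodies are disjoint. The strings form a
compact one-dimensional manifold `strings` in the part of `Y` outside of the inner bodies, whose
boundary points are exactly the pins; so its components are arcs between pins and closed loops.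
Strings are attached to the pins perpendicularly, that is, they follow the spokes near the boundary
of each body. -/
structure Diagram {ι : Type} (X : ι → PinnedBody) (Y : PinnedBody) where
  place : ι → ℂ ≃ₜ ℂ
  place_orientation : ∀ i, IsotopicToId (place i)
  place_interior : ∀ i, ∀ z ∈ (X i).body, Y.gauge (place i z) < 1
  place_disjoint : ∀ i j, i ≠ j → Disjoint (place i '' (X i).body) (place j '' (X j).body)
  strings : Set ℂ
  strings_closed : IsClosed strings
  strings_subset : strings ⊆ Y.body
  strings_avoid : ∀ i z, (X i).gauge z < 1 → place i z ∉ strings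
  strings_manifold : ∀ z ∈ strings, Y.gauge z < 1 → (∀ i, z ∉ place i '' (X i).body) →
    LocalArc strings z
  strings_outer : ∃ r < 1, ∀ z, r ≤ Y.gauge z → Y.gauge z ≤ 1 → (z ∈ strings ↔ z ∈ Y.spokes)
  strings_inner : ∀ i, ∃ r > 1, ∀ z, 1 ≤ (X i).gauge z → (X i).gauge z ≤ r →
    (place i z ∈ strings ↔ z ∈ (X i).spokes)

/-- Planar isotopy of diagrams, relative to the boundary of the outer body: an ambient isotopy
carries strings to strings and each inner body, with its pins, to its counterpart. (That it also
matches the two parametrizations of an inner body is no restriction: they differ by an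
orientation-preserving homeomorphism of the body that fixes the pins, which can be undone by an
isotopy in a collar of the body along the strings.) -/
def Diagram.Isotopic {ι : Type} {X : ι → PinnedBody} {Y : PinnedBody} (T T' : Diagram X Y) : Prop :=
  ∃ H : PlaneIsotopy, (∀ t z, 1 ≤ Y.gauge z → H.eval t z = z) ∧
    (∀ i, ∀ z ∈ (X i).body, H.eval 1 (T.place i z) = T'.place i z) ∧
    H.eval 1 '' T.strings = T'.strings

theorem LocalArc.image {S : Set ℂ} {z : ℂ} (h : LocalArc S z) (φ : ℂ ≃ₜ ℂ) :
    LocalArc (φ '' S) (φ z) := by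
  obtain ⟨γ, h1, h2, h3, h4, h5⟩ := h
  refine ⟨φ ∘ γ, φ.continuous.comp_continuousOn h1, φ.injective.comp_injOn h2, by simp [h3], ?_, ?_⟩
  · rw [image_comp]
    exact image_mono h4
  · rw [image_comp]
    have := image_mem_map (m := φ) h5
    rwa [φ.isEmbedding.map_nhdsWithin_eq] at this

theorem LocalArc.mono {S S' : Set ℂ} {z : ℂ} (h : LocalArc S z) (hS : S ⊆ S')
    (hS' : ∀ᶠ w in 𝓝 z, w ∈ S' → w ∈ S) : LocalArc S' z := by
  obtain ⟨γ, h1, h2, h3, h4, h5⟩ := h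
  refine ⟨γ, h1, h2, h3, h4.trans hS, ?_⟩
  rw [mem_nhdsWithin_iff_eventually] at h5 ⊢
  filter_upwards [h5, hS'] with w hw hw' hwS using hw (hw' hwS)

/-- A set that agrees with the spokes near a point of a spoke is an arc there. -/
theorem LocalArc.of_spokes (X : PinnedBody) (φ : ℂ ≃ₜ ℂ) {S : Set ℂ} {x : ℂ} (hx : x ∈ X.spokes)
    (hS : ∀ᶠ w in 𝓝 x, (φ w ∈ S ↔ w ∈ X.spokes)) : LocalArc S (φ x) := by
  obtain ⟨p, t, ht, rfl⟩ := hx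
  have hp0 : X.pin p ≠ 0 := by
    intro h
    have := X.gauge_pin p
    rw [h, X.gauge_zero] at this
    exact zero_ne_one this
  have hcont : Continuous fun s : ℝ => s • X.pin p := by fun_prop
  have hev : ∀ᶠ s in 𝓝 t, 0 < s ∧ (φ (s • X.pin p) ∈ S ↔ s • X.pin p ∈ X.spokes) :=
    (lt_mem_nhds ht).and (hcont.continuousAt.eventually hS)
  obtain ⟨ε, hε, hball⟩ := Metric.eventually_nhds_iff.1 hev
  have hmem : ∀ s ∈ Icc (-1 : ℝ) 1, 0 < t + ε / 2 * s ∧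
      φ ((t + ε / 2 * s) • X.pin p) ∈ S := by
    intro s hs
    obtain ⟨h1, h2⟩ := hball (y := t + ε / 2 * s) (by
      rw [Real.dist_eq, add_sub_cancel_left, abs_mul, abs_of_pos (half_pos hε)]
      have : |s| ≤ 1 := abs_le.2 hs
      nlinarith)
    exact ⟨h1, h2.2 ⟨p, _, h1, rfl⟩⟩
  have himage : (fun s : ℝ => φ ((t + ε / 2 * s) • X.pin p)) '' Icc (-1) 1 ∈
      𝓝[S] (φ (t • X.pin p)) := by
    rw [mem_nhdsWithin_iff_eventually, ← φ.map_nhds_eq, eventually_map]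
    have hg : ContinuousAt (fun w => (X.gauge w)⁻¹ • w) (t • X.pin p) := by
      have := X.continuous_gauge
      refine ContinuousAt.smul (ContinuousAt.inv₀ this.continuousAt ?_) continuousAt_id
      rw [X.gauge_smul _ _ ht.le, X.gauge_pin, mul_one]
      exact ht.ne'
    have hfin : (X.pin '' {q | q ≠ p}).Finite := by
      have := X.finite_pin
      exact Set.toFinite _
    have hval : (X.gauge (t • X.pin p))⁻¹ • (t • X.pin p) = X.pin p := by
      rw [X.gauge_smul _ _ ht.le, X.gauge_pin, mul_one, smul_smul, inv_mul_cancel₀ ht.ne', one_smul]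
    have hne : ∀ᶠ w in 𝓝 (t • X.pin p), (X.gauge w)⁻¹ • w ∉ X.pin '' {q | q ≠ p} := by
      refine hg.eventually (hfin.isClosed.isOpen_compl.mem_nhds ?_)
      rintro ⟨q, hq, hqp⟩
      exact hq (X.pin_injective (hqp.trans hval))
    have hnear : ∀ᶠ w in 𝓝 (t • X.pin p), dist (X.gauge w) t < ε / 2 := by
      have := X.continuous_gauge.continuousAt (x := t • X.pin p)
      rw [ContinuousAt, X.gauge_smul _ _ ht.le, X.gauge_pin, mul_one] at this
      exact this.eventually (Metric.ball_mem_nhds t (half_pos hε))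
    filter_upwards [hS, hne, hnear] with w h1 h2 h3 h4
    obtain ⟨q, s, hs, rfl⟩ := h1.1 h4
    rw [X.gauge_smul _ _ hs.le, X.gauge_pin, mul_one] at h2 h3
    rw [smul_smul, inv_mul_cancel₀ hs.ne', one_smul] at h2
    have hqp : q = p := by
      by_contra hqp
      exact h2 ⟨q, hqp, rfl⟩
    subst hqp
    refine ⟨(s - t) / (ε / 2), ?_, ?_⟩
    · rw [Real.dist_eq, abs_lt] at h3
      rw [mem_Icc, le_div_iff₀ (half_pos hε), div_le_iff₀ (half_pos hε)]
      constructor <;> linarith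
    · dsimp only
      congr 2
      field_simp
      ring
  refine ⟨_, ?_, ?_, ?_, ?_, himage⟩
  · have := φ.continuous
    exact Continuous.continuousOn (by fun_prop)
  · intro s _ s' _ h
    have h1 := smul_left_injective ℝ hp0 (φ.injective h)
    have : ε / 2 ≠ 0 := (half_pos hε).ne'
    exact mul_left_cancel₀ this (add_left_cancel h1)
  · simp
  · rintro _ ⟨s, hs, rfl⟩
    exact (hmem s hs).2

namespace Diagram

theorem Isotopic.refl {ι : Type} {X : ι → PinnedBody} {Y : PinnedBody} (T : Diagram X Y) :
    T.Isotopic T :=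
  ⟨PlaneIsotopy.refl, fun _ _ _ => rfl, fun _ _ _ => rfl, by
    ext
    simp [PlaneIsotopy.eval_refl]⟩

theorem Isotopic.symm {ι : Type} {X : ι → PinnedBody} {Y : PinnedBody} {T T' : Diagram X Y}
    (h : T.Isotopic T') : T'.Isotopic T := by
  obtain ⟨H, h1, h2, h3⟩ := h
  refine ⟨H.symm, ?_, ?_, ?_⟩
  · intro t z hz
    have := H.eval_symm_eval t z
    rwa [h1 t z hz] at this
  · intro i z hz
    rw [← h2 i z hz, H.eval_symm_eval]
  · rw [← h3, image_image]
    simp [H.eval_symm_eval]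

theorem Isotopic.trans {ι : Type} {X : ι → PinnedBody} {Y : PinnedBody} {T T' T'' : Diagram X Y}
    (h : T.Isotopic T') (h' : T'.Isotopic T'') : T.Isotopic T'' := by
  obtain ⟨H, h1, h2, h3⟩ := h
  obtain ⟨G, g1, g2, g3⟩ := h'
  refine ⟨H.trans G, ?_, ?_, ?_⟩
  · intro t z hz
    rw [PlaneIsotopy.eval_trans, h1 t z hz, g1 t z hz]
  · intro i z hz
    rw [PlaneIsotopy.eval_trans, h2 i z hz, g2 i z hz]
  · rw [← g3, ← h3, image_image]
    simp [PlaneIsotopy.eval_trans]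

/-- Diagrams up to planar isotopy. -/
instance setoid {ι : Type} (X : ι → PinnedBody) (Y : PinnedBody) : Setoid (Diagram X Y) where
  r := Isotopic
  iseqv := ⟨Isotopic.refl, Isotopic.symm, Isotopic.trans⟩

/-- Renaming the inner bodies. -/
noncomputable def reindex {ι κ : Type} {X : ι → PinnedBody} {Y : PinnedBody} (T : Diagram X Y) (e : κ ≃ ι) :
    Diagram (fun k => X (e k)) Y where
  place k := T.place (e k)
  place_orientation k := T.place_orientation (e k)
  place_interior k := T.place_interior (e k)
  place_disjoint j k h := T.place_disjoint _ _ (fun h' => h (e.injective h'))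
  strings := T.strings
  strings_closed := T.strings_closed
  strings_subset := T.strings_subset
  strings_avoid k := T.strings_avoid (e k)
  strings_manifold z hz h1 h2 := T.strings_manifold z hz h1 fun i => by
    obtain ⟨k, rfl⟩ := e.surjective i
    exact h2 k
  strings_outer := T.strings_outer
  strings_inner k := T.strings_inner (e k)

theorem isClosed_place {ι : Type} {X : ι → PinnedBody} {Y : PinnedBody} (T : Diagram X Y) (i : ι) :
    IsClosed (T.place i '' (X i).body) :=
  (T.place i).isClosedMap _ ((X i).isClosed_le 1)

section

variable {ι : Type} [Finite ι] {X : ι → PinnedBody} {Y : PinnedBody}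

/-- Near the outer boundary there are only spokes and no inner bodies. -/
theorem exists_outer (T : Diagram X Y) : ∃ r, 0 < r ∧ r < 1 ∧
    (∀ z, r ≤ Y.gauge z → Y.gauge z ≤ 1 → (z ∈ T.strings ↔ z ∈ Y.spokes)) ∧
    ∀ i, ∀ z ∈ (X i).body, Y.gauge (T.place i z) ≤ r := by
  obtain ⟨r, hr, h⟩ := T.strings_outer
  have hK : IsCompact (insert 0 (⋃ i, T.place i '' (X i).body)) :=
    (isCompact_iUnion fun i => ((X i).isCompact_le 1).image (T.place i).continuous).insert 0
  obtain ⟨w, hw, hmax⟩ := hK.exists_isMaxOn ⟨0, mem_insert _ _⟩ Y.continuous_gauge.continuousOn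
  have hw1 : Y.gauge w < 1 := by
    rcases hw with rfl | hw
    · rw [Y.gauge_zero]
      exact one_pos
    · obtain ⟨i, z, hz, rfl⟩ := mem_iUnion.1 hw
      exact T.place_interior i z hz
  refine ⟨max (1 / 2) (max r (Y.gauge w)), lt_max_of_lt_left (by norm_num), ?_, ?_, ?_⟩
  · exact max_lt (by norm_num) (max_lt hr hw1)
  · intro z hz
    exact h z (le_trans (le_trans (le_max_left _ _) (le_max_right _ _)) hz)
  · intro i z hz
    refine le_trans ?_ (le_trans (le_max_right _ _) (le_max_right _ _))
    exact hmax (mem_insert_of_mem _ (mem_iUnion.2 ⟨i, z, hz, rfl⟩))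

/-- The inner bodies have disjoint collars in which the strings are spokes. -/
theorem exists_inner (T : Diagram X Y) : ∃ c : ι → ℝ, (∀ i, 1 < c i) ∧
    (∀ i z, 1 ≤ (X i).gauge z → (X i).gauge z ≤ c i →
      (T.place i z ∈ T.strings ↔ z ∈ (X i).spokes)) ∧
    (∀ i z, (X i).gauge z ≤ c i → Y.gauge (T.place i z) < 1) ∧
    ∀ i j, i ≠ j → Disjoint (T.place i '' {z | (X i).gauge z ≤ c i})
      (T.place j '' {z | (X j).gauge z ≤ c j}) := by
  have hcpt : ∀ i, IsCompact (T.place i '' (X i).body) := fun i =>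
    ((X i).isCompact_le 1).image (T.place i).continuous
  have hsep : ∀ i j, ∃ U V : Set ℂ, IsOpen U ∧ IsOpen V ∧ (i ≠ j → T.place i '' (X i).body ⊆ U ∧
      T.place j '' (X j).body ⊆ V ∧ Disjoint U V) := by
    intro i j
    by_cases h : i = j
    · exact ⟨univ, univ, isOpen_univ, isOpen_univ, fun h' => absurd h h'⟩
    · obtain ⟨U, V, hU, hV, h1, h2, h3⟩ :=
        SeparatedNhds.of_isCompact_isCompact (hcpt i) (hcpt j) (T.place_disjoint i j h)
      exact ⟨U, V, hU, hV, fun _ => ⟨h1, h2, h3⟩⟩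
  choose U V hU hV hUV using hsep
  have hc : ∀ i, ∃ c > 1, {z | (X i).gauge z ≤ c} ⊆
      T.place i ⁻¹' ({z | Y.gauge z < 1} ∩ ⋂ j, {z | i ≠ j → z ∈ U i j ∩ V j i}) := by
    intro i
    refine (X i).exists_enlarge (IsOpen.preimage (T.place i).continuous (IsOpen.inter
      (isOpen_lt Y.continuous_gauge continuous_const) (isOpen_iInter_of_finite fun j => ?_))) ?_
    · by_cases h : i = j
      · simp [h]
      · simpa [h] using (hU i j).inter (hV j i)
    · intro z hz
      refine ⟨T.place_interior i z hz, mem_iInter.2 fun j h => ⟨?_, ?_⟩⟩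
      · exact (hUV i j h).1 ⟨z, hz, rfl⟩
      · exact (hUV j i h.symm).2.1 ⟨z, hz, rfl⟩
  choose c hc1 hc using hc
  choose r hr1 hr using T.strings_inner
  refine ⟨fun i => min (c i) (r i), fun i => lt_min (hc1 i) (hr1 i), ?_, ?_, ?_⟩
  · intro i z h1 h2
    exact hr i z h1 (h2.trans (min_le_right _ _))
  · intro i z h
    exact (hc i (show (X i).gauge z ≤ c i from h.trans (min_le_left _ _))).1
  · intro i j hij
    rw [disjoint_left]
    rintro _ ⟨z, hz, rfl⟩ ⟨w, hw, hwz⟩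
    have h1 := (mem_iInter.1 (hc i (show (X i).gauge z ≤ c i from le_trans hz (min_le_left _ _))).2 j hij).1
    have h2 := (mem_iInter.1 (hc j (show (X j).gauge w ≤ c j from le_trans hw (min_le_left _ _))).2 i hij.symm).2
    rw [hwz] at h2
    exact disjoint_left.1 (hUV i j hij).2.2 h1 h2

end


/-- The strings of the plugged diagram, seen inside of the `i`-th inner body. -/
theorem plug_strings_iff {ι : Type} {X : ι → PinnedBody} {Y : PinnedBody} {κ : ι → Type}
    {Z : (i : ι) → κ i → PinnedBody} (T : Diagram X Y) (U : (i : ι) → Diagram (Z i) (X i)) {i : ι} {x : ℂ}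
    (hx : ∀ j, i ≠ j → T.place i x ∉ T.place j '' (X j).body) :
    T.place i x ∈ T.strings ∪ ⋃ j, T.place j '' (U j).strings ↔
      T.place i x ∈ T.strings ∨ x ∈ (U i).strings := by
  constructor
  · rintro (h | h)
    · exact Or.inl h
    · obtain ⟨j, y, hy, hyx⟩ := mem_iUnion.1 h
      by_cases hij : i = j
      · subst hij
        exact Or.inr ((T.place i).injective hyx ▸ hy)
      · exact absurd ⟨y, (U j).strings_subset hy, hyx⟩ (hx j hij)
  · rintro (h | h)
    · exact Or.inl h
    · exact Or.inr (mem_iUnion.2 ⟨i, x, h, rfl⟩)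

section Plug

variable {ι : Type} [Finite ι] {X : ι → PinnedBody} {Y : PinnedBody} {κ : ι → Type}
  [∀ i, Finite (κ i)] {Z : (i : ι) → κ i → PinnedBody}

/-- Plugging the diagrams `U i` into the inner bodies of `T`. -/
noncomputable def plug (T : Diagram X Y) (U : (i : ι) → Diagram (Z i) (X i)) :
    Diagram (fun p : (i : ι) × κ i => Z p.1 p.2) Y where
  place p := ((U p.1).place p.2).trans (T.place p.1)
  place_orientation p := ((U p.1).place_orientation p.2).trans (T.place_orientation p.1)
  place_interior p z hz := T.place_interior p.1 _ ((U p.1).place_interior p.2 z hz).le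
  place_disjoint := by
    rintro ⟨i, j⟩ ⟨i', j'⟩ h
    rw [disjoint_left]
    rintro _ ⟨z, hz, rfl⟩ ⟨w, hw, hwz⟩
    dsimp only [Homeomorph.trans_apply] at hz hw hwz
    have hz' := ((U i).place_interior j z hz).le
    have hw' := ((U i').place_interior j' w hw).le
    by_cases hi : i = i'
    · subst hi
      have hj : j ≠ j' := fun hj => h (by rw [hj])
      exact disjoint_left.1 ((U i).place_disjoint j j' hj) ⟨z, hz, rfl⟩
        ⟨w, hw, (T.place i).injective hwz⟩
    · exact disjoint_left.1 (T.place_disjoint i i' hi) ⟨_, hz', rfl⟩ ⟨_, hw', hwz⟩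
  strings := T.strings ∪ ⋃ i, T.place i '' (U i).strings
  strings_closed := T.strings_closed.union
    (isClosed_iUnion_of_finite fun i => (T.place i).isClosedMap _ (U i).strings_closed)
  strings_subset := by
    refine union_subset T.strings_subset (iUnion_subset fun i => ?_)
    rintro _ ⟨z, hz, rfl⟩
    exact (T.place_interior i z ((U i).strings_subset hz)).le
  strings_avoid := by
    rintro ⟨i, j⟩ z hz
    have hz' := (U i).place_interior j z hz.le
    change T.place i ((U i).place j z) ∉ _
    rw [T.plug_strings_iff U]
    · rintro (h | h)
      · exact T.strings_avoid i _ hz' h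
      · exact (U i).strings_avoid j z hz h
    · intro j' hj' hmem
      exact disjoint_left.1 (T.place_disjoint i j' hj') ⟨_, hz'.le, rfl⟩ hmem
  strings_manifold := by
    intro z hz hz1 hz2
    by_cases hb : ∃ i, z ∈ T.place i '' (X i).body
    · obtain ⟨i, x, hx, rfl⟩ := hb
      obtain ⟨c, hc1, hc2, hc3, hc4⟩ := T.exists_inner
      have hdisj : ∀ w, (X i).gauge w ≤ c i → ∀ j, i ≠ j →
          T.place i w ∉ T.place j '' (X j).body := by
        rintro w hw j hij ⟨y, hy, hyw⟩
        exact disjoint_left.1 (hc4 i j hij) ⟨w, hw, rfl⟩ ⟨y, le_trans hy (hc1 j).le, hyw⟩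
      have hx1 : (X i).gauge x ≤ 1 := hx
      rw [T.plug_strings_iff U (hdisj x (hx1.trans (hc1 i).le))] at hz
      rcases hx1.lt_or_eq with hlt | heq
      · have hxU : x ∈ (U i).strings := hz.resolve_left (T.strings_avoid i x hlt)
        refine LocalArc.mono (((U i).strings_manifold x hxU hlt ?_).image (T.place i)) ?_ ?_
        · rintro j ⟨y, hy, hyx⟩
          exact hz2 ⟨i, j⟩ ⟨y, hy, congrArg (T.place i) hyx⟩
        · exact fun w hw => Or.inr (mem_iUnion.2 ⟨i, hw⟩)
        · rw [← (T.place i).map_nhds_eq, eventually_map]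
          filter_upwards [(isOpen_lt (X i).continuous_gauge continuous_const).mem_nhds hlt]
            with w hw hwS
          have hw1 : (X i).gauge w < 1 := hw
          rw [T.plug_strings_iff U (hdisj w (hw1.le.trans (hc1 i).le))] at hwS
          exact ⟨w, hwS.resolve_left (T.strings_avoid i w hw1), rfl⟩
      · obtain ⟨r, -, hr1, hr, -⟩ := (U i).exists_outer
        refine LocalArc.of_spokes (X i) (T.place i) ?_ ?_
        · rcases hz with hz | hz
          · exact (hc2 i x heq.ge (heq.le.trans (hc1 i).le)).1 hz
          · exact (hr x (heq ▸ hr1.le) heq.le).1 hz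
        · have h1 : ∀ᶠ w in 𝓝 x, r < (X i).gauge w :=
            (isOpen_lt continuous_const (X i).continuous_gauge).mem_nhds (show r < _ by rwa [heq])
          have h2 : ∀ᶠ w in 𝓝 x, (X i).gauge w < c i :=
            (isOpen_lt (X i).continuous_gauge continuous_const).mem_nhds
              (show _ < c i by rw [heq]; exact hc1 i)
          filter_upwards [h1, h2] with w hw1 hw2
          rw [T.plug_strings_iff U (hdisj w hw2.le)]
          rcases lt_trichotomy ((X i).gauge w) 1 with h | h | h
          · rw [or_iff_right (T.strings_avoid i w h)]
            exact hr w hw1.le h.le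
          · rw [hr w hw1.le h.le, hc2 i w h.ge hw2.le, or_self]
          · rw [or_iff_left fun hU => absurd ((U i).strings_subset hU) (not_le.2 h)]
            exact hc2 i w h.le hw2.le
    · push Not at hb
      have hout : ∀ w, (∀ i, w ∉ T.place i '' (X i).body) →
          w ∈ T.strings ∪ ⋃ i, T.place i '' (U i).strings → w ∈ T.strings := by
        rintro w hw (h | h)
        · exact h
        · obtain ⟨i, y, hy, hyw⟩ := mem_iUnion.1 h
          exact absurd ⟨y, (U i).strings_subset hy, hyw⟩ (hw i)
      refine (T.strings_manifold z (hout z hb hz) hz1 hb).mono subset_union_left ?_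
      have : ∀ᶠ w in 𝓝 z, ∀ i, w ∉ T.place i '' (X i).body :=
        eventually_all.2 fun i => (T.isClosed_place i).isOpen_compl.mem_nhds (hb i)
      filter_upwards [this] with w hw using hout w hw
  strings_outer := by
    obtain ⟨r, -, hr1, hr, hr2⟩ := T.exists_outer
    refine ⟨(1 + r) / 2, by linarith, fun z hz hz' => ?_⟩
    rw [← hr z (by linarith) hz']
    refine ⟨fun h => h.resolve_right fun h' => ?_, Or.inl⟩
    obtain ⟨i, y, hy, rfl⟩ := mem_iUnion.1 h'
    have := hr2 i y ((U i).strings_subset hy)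
    linarith
  strings_inner := by
    rintro ⟨i, j⟩
    obtain ⟨c, hc1, hc2, hc3, -⟩ := (U i).exists_inner
    refine ⟨c j, hc1 j, fun z hz hz' => ?_⟩
    have hlt := hc3 j z hz'
    rw [← hc2 j z hz hz']
    change T.place i ((U i).place j z) ∈ _ ↔ _
    rw [T.plug_strings_iff U, or_iff_right (T.strings_avoid i _ hlt)]
    intro j' hj' hmem
    exact disjoint_left.1 (T.place_disjoint i j' hj') ⟨_, hlt.le, rfl⟩ hmem

/-- Plugging is compatible with planar isotopy. -/
theorem plug_isotopic {T T' : Diagram X Y} {U U' : (i : ι) → Diagram (Z i) (X i)}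
    (h : T.Isotopic T') (h' : ∀ i, (U i).Isotopic (U' i)) :
    (T.plug U).Isotopic (T'.plug U') := by
  obtain ⟨H, h1, h2, h3⟩ := h
  choose G g1 g2 g3 using h'
  obtain ⟨K, k1, k2⟩ := PlaneIsotopy.exists_glue T'.place (fun i => (X i).body) T'.place_disjoint G
    (fun i t z hz => g1 i t z (not_le.1 hz).le)
  refine ⟨H.trans K, ?_, ?_, ?_⟩
  · intro t z hz
    rw [PlaneIsotopy.eval_trans, h1 t z hz, k2]
    rintro i ⟨x, hx, rfl⟩
    exact absurd (T'.place_interior i x hx) (not_lt.2 hz)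
  · rintro ⟨i, j⟩ z hz
    rw [PlaneIsotopy.eval_trans]
    have hz' := ((U i).place_interior j z hz).le
    change K.eval 1 (H.eval 1 (T.place i ((U i).place j z))) = T'.place i ((U' i).place j z)
    rw [h2 i _ hz', k1 i 1 _ hz', g2 i j z hz]
  · have hK : ∀ z ∈ T'.strings, K.eval 1 z = z := by
      intro z hz
      by_cases hb : ∃ i, z ∈ T'.place i '' (X i).body
      · obtain ⟨i, x, hx, rfl⟩ := hb
        have hx1 : 1 ≤ (X i).gauge x := not_lt.1 fun hlt => T'.strings_avoid i x hlt hz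
        rw [k1 i 1 x hx, g1 i 1 x hx1]
      · push Not at hb
        exact k2 1 z hb
    have hfun : (H.trans K).eval 1 = K.eval 1 ∘ H.eval 1 :=
      funext fun z => PlaneIsotopy.eval_trans H K 1 z
    change (H.trans K).eval 1 '' (T.strings ∪ ⋃ i, T.place i '' (U i).strings) =
      T'.strings ∪ ⋃ i, T'.place i '' (U' i).strings
    rw [hfun, image_comp, image_union, h3, image_union, image_congr hK, image_id', image_iUnion,
      image_iUnion]
    congr 1
    refine iUnion_congr fun i => ?_
    rw [← g3 i, image_image, image_image, image_image]
    refine image_congr fun z hz => ?_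
    have hz' := (U i).strings_subset hz
    rw [h2 i z hz', k1 i 1 z hz']

end Plug

/-! ### The identity diagrams -/

/-- Multiplication by `1 / 2`. -/
noncomputable def half : ℂ ≃ₜ ℂ := Homeomorph.smulOfNeZero (1 / 2 : ℝ) (by norm_num)

theorem half_apply (z : ℂ) : half z = (1 / 2 : ℝ) • z := rfl

theorem half_isotopicToId : IsotopicToId half := by
  have h0 : ∀ t : I, (1 - (t : ℝ) / 2) ≠ 0 := fun t => by
    have := t.2.2
    linarith
  refine ⟨⟨⟨⟨fun x => (x.1, (1 - (x.1 : ℝ) / 2) • x.2),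
    fun x => (x.1, (1 - (x.1 : ℝ) / 2)⁻¹ • x.2), ?_, ?_⟩, ?_, ?_⟩, fun _ => rfl, ?_⟩, ?_⟩
  · rintro ⟨t, z⟩
    dsimp only
    rw [smul_smul, inv_mul_cancel₀ (h0 t), one_smul]
  · rintro ⟨t, z⟩
    dsimp only
    rw [smul_smul, mul_inv_cancel₀ (h0 t), one_smul]
  · dsimp only
    fun_prop
  · dsimp only
    have h1 : ∀ x : I × ℂ, (1 - (x.1 : ℝ) / 2) ≠ 0 := fun x => h0 x.1
    fun_prop (disch := assumption)
  · intro z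
    change ((0 : I), (1 - ((0 : I) : ℝ) / 2) • z) = (0, z)
    simp
  · intro z
    change (1 - ((1 : I) : ℝ) / 2) • z = (1 / 2 : ℝ) • z
    norm_num

theorem gauge_half (X : PinnedBody) (z : ℂ) : X.gauge (half z) = X.gauge z / 2 := by
  rw [half_apply, X.gauge_smul _ _ (by norm_num)]
  ring

theorem half_mem_spokes (X : PinnedBody) (z : ℂ) : half z ∈ X.spokes ↔ z ∈ X.spokes :=
  X.smul_mem_spokes (by norm_num) z

theorem spokes_closed (X : PinnedBody) :
    IsClosed {z | z ∈ X.spokes ∧ 1 / 2 ≤ X.gauge z ∧ X.gauge z ≤ 1} := by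
  have : {z | z ∈ X.spokes ∧ 1 / 2 ≤ X.gauge z ∧ X.gauge z ≤ 1} =
      ⋃ p : X.Pin, (fun t : ℝ => t • X.pin p) '' Icc (1 / 2) 1 := by
    ext z
    simp only [mem_ofPred_eq, mem_iUnion]
    constructor
    · rintro ⟨⟨p, t, ht, rfl⟩, h1, h2⟩
      rw [X.gauge_smul _ _ ht.le, X.gauge_pin, mul_one] at h1 h2
      exact ⟨p, t, ⟨h1, h2⟩, rfl⟩
    · rintro ⟨p, t, ⟨h1, h2⟩, rfl⟩
      have ht : 0 < t := by linarith
      refine ⟨⟨p, t, ht, rfl⟩, ?_⟩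
      dsimp only
      rw [X.gauge_smul _ _ ht.le, X.gauge_pin, mul_one]
      exact ⟨h1, h2⟩
  rw [this]
  have := X.finite_pin
  exact isClosed_iUnion_of_finite fun p => (isCompact_Icc.image (by fun_prop)).isClosed

/-- The identity diagram: a half-size copy of `X` inside of `X`, and spokes. -/
noncomputable def ident (X : PinnedBody) : Diagram (fun _ : Fin 1 => X) X where
  place _ := half
  place_orientation _ := half_isotopicToId
  place_interior _ z hz := by
    have hz' : X.gauge z ≤ 1 := hz
    rw [gauge_half]
    linarith
  place_disjoint i j h := absurd (Subsingleton.elim i j) h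
  strings := {z | z ∈ X.spokes ∧ 1 / 2 ≤ X.gauge z ∧ X.gauge z ≤ 1}
  strings_closed := spokes_closed X
  strings_subset z hz := hz.2.2
  strings_avoid _ z hz h := by
    have := h.2.1
    rw [gauge_half] at this
    linarith
  strings_manifold z hz h1 h2 := by
    have hgt : 1 / 2 < X.gauge z := by
      refine lt_of_le_of_ne hz.2.1 fun h => h2 0 ⟨(2 : ℝ) • z, ?_, ?_⟩
      · change X.gauge ((2 : ℝ) • z) ≤ 1
        rw [X.gauge_smul _ _ (by norm_num), ← h]
        norm_num
      · rw [half_apply, smul_smul]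
        norm_num
    refine LocalArc.of_spokes X (Homeomorph.refl ℂ) hz.1 ?_
    filter_upwards [(isOpen_lt continuous_const X.continuous_gauge).mem_nhds hgt,
      (isOpen_lt X.continuous_gauge continuous_const).mem_nhds h1] with w hw1 hw2
    exact ⟨fun h => h.1, fun h => ⟨h, le_of_lt hw1, le_of_lt hw2⟩⟩
  strings_outer := ⟨1 / 2, by norm_num, fun z h1 h2 => ⟨fun h => h.1, fun h => ⟨h, h1, h2⟩⟩⟩
  strings_inner _ := ⟨2, by norm_num, fun z h1 h2 => by
    change (half z ∈ X.spokes ∧ _) ↔ _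
    rw [half_mem_spokes, gauge_half]
    exact ⟨fun h => h.1, fun h => ⟨h, by linarith, by linarith⟩⟩⟩

/-! ### The multicategory of planar diagrams -/

/-- Equality of classes of diagrams whose sequences of inputs are not definitionally equal. -/
theorem mk_heq {d d' : ℕ} {X : Fin d → PinnedBody} {X' : Fin d' → PinnedBody} {Y : PinnedBody}
    (hd : d = d') (hX : ∀ i, X i = X' (Fin.cast hd i)) (T : Diagram X Y) (T' : Diagram X' Y)
    (H : PlaneIsotopy) (h1 : ∀ t z, 1 ≤ Y.gauge z → H.eval t z = z)
    (h2 : ∀ i, ∀ z ∈ (X i).body, H.eval 1 (T.place i z) = T'.place (Fin.cast hd i) z)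
    (h3 : H.eval 1 '' T.strings = T'.strings) :
    HEq (Quotient.mk (setoid X Y) T) (Quotient.mk (setoid X' Y) T') := by
  subst hd
  obtain rfl : X = X' := funext hX
  exact heq_of_eq (Quotient.sound ⟨H, h1, h2, h3⟩)

/-- Plugging of isotopy classes. -/
noncomputable def plugClass {d : ℕ} {X : Fin d → PinnedBody} {Y : PinnedBody} {e : Fin d → ℕ}
    {Z : (i : Fin d) → Fin (e i) → PinnedBody} (T : Quotient (setoid X Y))
    (U : (i : Fin d) → Quotient (setoid (Z i) (X i))) : Quotient (setoid (concat Z) Y) :=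
  Quotient.mk _ ((plug T.out fun i => (U i).out).reindex finSigmaFinEquiv.symm)

theorem plugClass_mk {d : ℕ} {X : Fin d → PinnedBody} {Y : PinnedBody} {e : Fin d → ℕ}
    {Z : (i : Fin d) → Fin (e i) → PinnedBody} (T : Diagram X Y)
    (U : (i : Fin d) → Diagram (Z i) (X i)) :
    plugClass (Quotient.mk (setoid X Y) T) (fun i => Quotient.mk (setoid (Z i) (X i)) (U i)) =
      Quotient.mk (setoid (concat Z) Y) ((plug T U).reindex finSigmaFinEquiv.symm) := by
  obtain ⟨H, h1, h2, h3⟩ := plug_isotopic (Z := Z) (Quotient.mk_out T : Isotopic _ T)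
    (fun i => (Quotient.mk_out (U i) : Isotopic _ (U i)))
  exact Quotient.sound ⟨H, h1, fun k => h2 _, h3⟩

theorem plugClass_ident {d : ℕ} {X : Fin d → PinnedBody} {Y : PinnedBody}
    (T : Quotient (setoid X Y)) :
    HEq (plugClass T fun i => Quotient.mk (setoid _ _) (ident (X i))) T := by
  induction T using Quotient.inductionOn with | h T => ?_
  rw [plugClass_mk]
  have hs : ∀ l : Fin (∑ _ : Fin d, 1), (finSigmaFinEquiv.symm l).1 = Fin.cast (by simp) l := by
    intro l
    obtain ⟨⟨i, j⟩, rfl⟩ := finSigmaFinEquiv.surjective l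
    rw [Equiv.symm_apply_apply]
    obtain rfl : j = 0 := Subsingleton.elim _ _
    exact Fin.ext (finSigma_one d i).symm
  obtain ⟨c, hc1, hc2, hc3, hc4⟩ := T.exists_inner
  obtain ⟨K, k1, k2⟩ := PlaneIsotopy.exists_glue T.place (fun i => {z | (X i).gauge z ≤ c i}) hc4
    (fun i => (X i).radial one_pos (hc1 i))
    (fun i t z hz => (X i).radial_outer _ _ t (not_le.1 hz).le)
  refine mk_heq (by simp) (fun l => congrArg X (hs l)) _ _ K ?_ ?_ ?_
  · intro t z hz
    refine k2 t z ?_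
    rintro i ⟨x, hx, rfl⟩
    exact absurd (hc3 i x hx) (not_lt.2 hz)
  · intro l z hz
    rw [← hs l]
    change K.eval 1 (T.place (finSigmaFinEquiv.symm l).1 (half z)) = _
    generalize (finSigmaFinEquiv.symm l).1 = i at hz ⊢
    have hz' : (X i).gauge z ≤ 1 := hz
    have hh : (X i).gauge (half z) ≤ 1 / 2 := by
      rw [gauge_half]
      linarith
    rw [k1 i 1 _ (show (X i).gauge (half z) ≤ c i by have := hc1 i; linarith),
      (X i).radial_inner _ _ hh, half_apply, smul_smul]
    norm_num
  · refine K.image_eq_of_iff fun w => ?_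
    change w ∈ T.strings ∪ ⋃ i, T.place i '' (ident (X i)).strings ↔ _
    by_cases hw : ∃ i, w ∈ T.place i '' {z | (X i).gauge z ≤ c i}
    · obtain ⟨i, x, hx, rfl⟩ := hw
      have hx' : (X i).gauge x ≤ c i := hx
      rw [T.plug_strings_iff (fun i => ident (X i)), k1 i 1 x hx]
      · rcases lt_or_ge ((X i).gauge x) (1 / 2) with h | h
        · have h1 : T.place i x ∉ T.strings := T.strings_avoid i x (by linarith)
          have h2 : T.place i (((X i).radial one_pos (hc1 i)).eval 1 x) ∉ T.strings := by
            refine T.strings_avoid i _ ?_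
            rw [(X i).radial_inner _ _ h.le, (X i).gauge_smul _ _ (by norm_num)]
            linarith
          have h3 : x ∉ (ident (X i)).strings := fun h' => absurd h'.2.1 (not_le.2 h)
          tauto
        · obtain ⟨m1, m2⟩ := (X i).radial_mid one_pos (hc1 i) h hx'
          rw [hc2 i _ m1 m2, PinnedBody.radial_mem_spokes]
          rcases lt_or_ge ((X i).gauge x) 1 with h' | h'
          · rw [or_iff_right (T.strings_avoid i x h')]
            exact ⟨fun h => h.1, fun h'' => ⟨h'', h, h'.le⟩⟩
          · rw [hc2 i x h' hx']
            exact ⟨fun h => h.elim (fun h => h) (fun h => h.1), Or.inl⟩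
      · rintro j hij ⟨y, hy, hyx⟩
        exact disjoint_left.1 (hc4 i j hij) ⟨x, hx, rfl⟩ ⟨y, le_trans hy (hc1 j).le, hyx⟩
    · push Not at hw
      rw [k2 1 w hw]
      refine or_iff_left fun h => ?_
      obtain ⟨i, y, hy, hyw⟩ := mem_iUnion.1 h
      exact hw i ⟨y, le_trans hy.2.2 (hc1 i).le, hyw⟩

theorem ident_plugClass {d : ℕ} {X : Fin d → PinnedBody} {Y : PinnedBody}
    (T : Quotient (setoid X Y)) :
    HEq (plugClass (Quotient.mk (setoid _ _) (ident Y)) fun _ => T) T := by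
  induction T using Quotient.inductionOn with | h T => ?_
  rw [plugClass_mk]
  have hs : ∀ l : Fin (∑ _ : Fin 1, d), (finSigmaFinEquiv.symm l).2 = Fin.cast (by simp) l := by
    intro l
    obtain ⟨⟨i, j⟩, rfl⟩ := finSigmaFinEquiv.surjective l
    rw [Equiv.symm_apply_apply]
    exact Fin.ext (finSigmaFinEquiv_one _).symm
  obtain ⟨r, hr0, hr1, hr2, hr3⟩ := T.exists_outer
  refine mk_heq (by simp) (fun l => congrArg X (hs l)) _ _ (Y.radial hr0 hr1) ?_ ?_ ?_
  · exact fun t z hz => Y.radial_outer _ _ t hz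
  · intro l z hz
    rw [← hs l]
    change (Y.radial hr0 hr1).eval 1 (half (T.place (finSigmaFinEquiv.symm l).2 z)) = _
    have := hr3 (finSigmaFinEquiv.symm l).2 z hz
    rw [Y.radial_inner, half_apply, smul_smul]
    · norm_num
    · rw [gauge_half]
      linarith
  · refine PlaneIsotopy.image_eq_of_iff _ fun w => ?_
    change w ∈ (ident Y).strings ∪ ⋃ i : Fin 1, half '' T.strings ↔ _
    have hw : w ∈ ⋃ _ : Fin 1, half '' T.strings ↔ (2 : ℝ) • w ∈ T.strings := by
      rw [mem_iUnion]
      constructor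
      · rintro ⟨-, y, hy, rfl⟩
        rw [half_apply, smul_smul]
        norm_num
        exact hy
      · intro h
        refine ⟨0, _, h, ?_⟩
        rw [half_apply, smul_smul]
        norm_num
    have h2 : Y.gauge ((2 : ℝ) • w) = 2 * Y.gauge w := Y.gauge_smul _ _ (by norm_num)
    have hs2 := Y.smul_mem_spokes (show (0 : ℝ) < 2 by norm_num) w
    rw [mem_union, hw]
    rcases le_total (Y.gauge w) (r / 2) with h | h
    · rw [Y.radial_inner _ _ h]
      refine or_iff_right fun h' => ?_
      have := h'.2.1
      linarith
    · rcases le_or_gt (Y.gauge w) 1 with h' | h'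
      · obtain ⟨m1, m2⟩ := Y.radial_mid hr0 hr1 h h'
        rw [hr2 _ m1 m2, PinnedBody.radial_mem_spokes]
        rcases lt_or_ge (Y.gauge w) (1 / 2) with h3 | h3
        · rw [hr2 _ (by linarith) (by linarith), hs2]
          exact ⟨fun h => h.elim (fun h => h.1) (fun h => h), Or.inr⟩
        · constructor
          · rintro (h4 | h4)
            · exact h4.1
            · have h5 : Y.gauge ((2 : ℝ) • w) ≤ 1 := T.strings_subset h4
              exact hs2.1 ((hr2 _ (by linarith) h5).1 h4)
          · exact fun h4 => Or.inl ⟨h4, h3, h'⟩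
      · rw [Y.radial_outer _ _ _ h'.le]
        constructor
        · rintro (h4 | h4)
          · exact absurd h4.2.2 (not_le.2 h')
          · have h5 : Y.gauge ((2 : ℝ) • w) ≤ 1 := T.strings_subset h4
            linarith
        · intro h4
          exact absurd (T.strings_subset h4) (not_le.2 h')

theorem plugClass_assoc {d : ℕ} {X : Fin d → PinnedBody} {Y : PinnedBody} {e : Fin d → ℕ}
    {Z : (i : Fin d) → Fin (e i) → PinnedBody} {f : (i : Fin d) → Fin (e i) → ℕ}
    {V : (i : Fin d) → (j : Fin (e i)) → Fin (f i j) → PinnedBody}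
    (T : Quotient (setoid X Y)) (U : (i : Fin d) → Quotient (setoid (Z i) (X i)))
    (W : (i : Fin d) → (j : Fin (e i)) → Quotient (setoid (V i j) (Z i j))) :
    HEq (plugClass (plugClass T U)
        (fun k => W (finSigmaFinEquiv.symm k).1 (finSigmaFinEquiv.symm k).2))
      (plugClass T (fun i => plugClass (U i) (W i))) := by
  induction T using Quotient.inductionOn with | h T => ?_
  obtain ⟨U, rfl⟩ : ∃ U' : (i : Fin d) → Diagram (Z i) (X i),
      U = fun i => Quotient.mk (setoid (Z i) (X i)) (U' i) :=
    ⟨fun i => (U i).out, funext fun i => (Quotient.out_eq _).symm⟩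
  obtain ⟨W, rfl⟩ : ∃ W' : (i : Fin d) → (j : Fin (e i)) → Diagram (V i j) (Z i j),
      W = fun i j => Quotient.mk (setoid (V i j) (Z i j)) (W' i j) :=
    ⟨fun i j => (W i j).out, funext fun i => funext fun j => (Quotient.out_eq _).symm⟩
  simp only [plugClass_mk]
  have hs : ∀ n : Fin (∑ k, concat f k), ∀ n' : Fin (∑ i, ∑ j, f i j), (n : ℕ) = n' →
      (⟨(finSigmaFinEquiv.symm (finSigmaFinEquiv.symm n).1).1,
        ⟨(finSigmaFinEquiv.symm (finSigmaFinEquiv.symm n).1).2, (finSigmaFinEquiv.symm n).2⟩⟩ :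
        (i : Fin d) × (j : Fin (e i)) × Fin (f i j)) =
      ⟨(finSigmaFinEquiv.symm n').1, finSigmaFinEquiv.symm (finSigmaFinEquiv.symm n').2⟩ := by
    intro n n' h
    obtain ⟨⟨k, l⟩, rfl⟩ := finSigmaFinEquiv.surjective n
    obtain rfl := Fin.ext (h.symm.trans (finSigma_assoc k l))
    rw [Equiv.symm_apply_apply, Equiv.symm_apply_apply]
    dsimp only
    rw [Equiv.symm_apply_apply]
  refine mk_heq (finSigma_assoc_card f) (fun n => congrArg (fun q => V q.1 q.2.1 q.2.2)
    (hs n _ rfl)) _ _ PlaneIsotopy.refl (fun _ _ _ => rfl) ?_ ?_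
  · intro n z _
    exact congrArg (fun q : (i : Fin d) × (j : Fin (e i)) × Fin (f i j) =>
      T.place q.1 ((U q.1).place q.2.1 ((W q.1 q.2.1).place q.2.2 z))) (hs n _ rfl)
  · have : PlaneIsotopy.refl.eval 1 = id := rfl
    rw [this, image_id]
    change (T.strings ∪ ⋃ i, T.place i '' (U i).strings) ∪ ⋃ k : Fin (∑ i, e i),
        (((U (finSigmaFinEquiv.symm k).1).place (finSigmaFinEquiv.symm k).2).trans
          (T.place (finSigmaFinEquiv.symm k).1)) ''
            (W (finSigmaFinEquiv.symm k).1 (finSigmaFinEquiv.symm k).2).strings =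
      T.strings ∪ ⋃ i, T.place i '' ((U i).strings ∪ ⋃ j, (U i).place j '' (W i j).strings)
    rw [finSigmaFinEquiv.symm.surjective.iUnion_comp (fun p : (i : Fin d) × Fin (e i) =>
      (((U p.1).place p.2).trans (T.place p.1)) '' (W p.1 p.2).strings), iUnion_sigma]
    simp only [image_union, image_iUnion, iUnion_union_distrib, union_assoc, image_image]
    rfl

end Diagram

/-- The multicategory of planar diagrams with the given family of pinned bodies as objects:
morphisms are diagrams up to planar isotopy, and composition is plugging. -/
noncomputable def diagrams {O : Type} (B : O → PinnedBody) : Multicategory where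
  Obj := O
  Hom X Y := Quotient (Diagram.setoid (fun i => B (X i)) (B Y))
  id X := Quotient.mk _ (Diagram.ident (B X))
  comp T U := Diagram.plugClass T U
  id_comp T := Diagram.ident_plugClass T
  comp_id T := Diagram.plugClass_ident T
  assoc T U W := Diagram.plugClass_assoc T U W

/-! ### Disks and boxes -/

/-- The `n`-disk: the unit disk with pins at the `n`-th roots of unity, numbered
anticlockwise. -/
noncomputable def disk (n : ℕ) : PinnedBody where
  gauge z := ‖z‖
  continuous_gauge := continuous_norm
  gauge_smul t z ht := by rw [norm_smul, Real.norm_of_nonneg ht]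
  gauge_pos z hz := norm_pos_iff.2 hz
  Pin := Fin n
  finite_pin := inferInstance
  pin k := Complex.exp (2 * Real.pi * Complex.I * (k / n))
  pin_injective := by
    intro k l h
    have hn : n ≠ 0 := by
      rintro rfl
      exact k.elim0
    have key : ∀ k : Fin n, Complex.exp (2 * Real.pi * Complex.I * (k / n)) =
        Complex.exp (2 * Real.pi * Complex.I / n) ^ (k : ℕ) := by
      intro k
      rw [← Complex.exp_nat_mul]
      congr 1
      ring
    simp only [key] at h
    exact Fin.ext ((Complex.isPrimitiveRoot_exp n hn).pow_inj k.2 l.2 h)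
  gauge_pin k := by
    have : (2 * Real.pi * Complex.I * (k / n) : ℂ) = ((2 * Real.pi * (k / n) : ℝ) : ℂ) * Complex.I := by
      push_cast
      ring
    rw [this, Complex.norm_exp_ofReal_mul_I]

/-- The `i`-th of `m` equidistant interior points of `[-1, 1]`, from left to right. -/
noncomputable def edgePoint (m : ℕ) (i : Fin m) : ℝ := -1 + 2 * (i + 1) / (m + 1)

theorem edgePoint_injective (m : ℕ) : Function.Injective (edgePoint m) := by
  intro i j h
  have hm : (m + 1 : ℝ) ≠ 0 := by positivity
  have h1 : (2 * ((i : ℕ) + 1) / (m + 1) : ℝ) = 2 * ((j : ℕ) + 1) / (m + 1) := add_left_cancel h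
  rw [div_left_inj' hm] at h1
  exact Fin.ext (by exact_mod_cast (by linarith : ((i : ℕ) : ℝ) = (j : ℕ)))

theorem abs_edgePoint_le (m : ℕ) (i : Fin m) : |edgePoint m i| ≤ 1 := by
  have hm : (0 : ℝ) < m + 1 := by positivity
  have hi : ((i : ℕ) : ℝ) + 1 ≤ m := by exact_mod_cast i.2
  have h1 : 2 * (((i : ℕ) : ℝ) + 1) / (m + 1) ≤ 2 := by
    rw [div_le_iff₀ hm]
    linarith
  have h2 : 0 ≤ 2 * (((i : ℕ) : ℝ) + 1) / (m + 1) := by positivity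
  rw [edgePoint, abs_le]
  constructor <;> linarith

/-- The `(m, n)`-box: the square `[-1, 1] × [-1, 1]` with `m` pins on the lower and `n` pins on the
upper edge, both numbered from left to right. -/
noncomputable def box (p : ℕ × ℕ) : PinnedBody where
  gauge z := max |z.re| |z.im|
  continuous_gauge := by fun_prop
  gauge_smul t z ht := by
    simp only [Complex.real_smul, Complex.re_ofReal_mul, Complex.im_ofReal_mul, abs_mul,
      abs_of_nonneg ht]
    rw [mul_max_of_nonneg _ _ ht]
  gauge_pos z hz := by
    by_contra h
    obtain ⟨h1, h2⟩ := max_le_iff.1 (not_lt.1 h)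
    exact hz (Complex.ext (abs_nonpos_iff.1 h1) (abs_nonpos_iff.1 h2))
  Pin := Fin p.1 ⊕ Fin p.2
  finite_pin := inferInstance
  pin := Sum.elim (fun i => ⟨edgePoint p.1 i, -1⟩) (fun j => ⟨edgePoint p.2 j, 1⟩)
  pin_injective := by
    rintro (i | i) (j | j) h
    · rw [edgePoint_injective _ (congrArg Complex.re h)]
    · have := congrArg Complex.im h
      norm_num at this
    · have := congrArg Complex.im h
      norm_num at this
    · rw [edgePoint_injective _ (congrArg Complex.re h)]
  gauge_pin := by
    rintro (i | j)
    · simpa using abs_edgePoint_le p.1 i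
    · simpa using abs_edgePoint_le p.2 j

/-- The multicategory of planar diagrams of disk type. -/
noncomputable def diskDiagrams : Multicategory := diagrams disk

/-- The multicategory of planar diagrams of box type. -/
noncomputable def boxDiagrams : Multicategory := diagrams box

/-- Planar diagrams of disk type, with disks that have an even number of pins. -/
noncomputable def evenDiskDiagrams : Multicategory := diskDiagrams.full fun n : ℕ => Even n

/-- Planar diagrams of box type, with boxes that have an even total number of pins. -/
noncomputable def evenBoxDiagrams : Multicategory :=
  boxDiagrams.full fun p : ℕ × ℕ => Even (p.1 + p.2)

/-- Diagonal diagrams: planar diagrams of box type, with boxes of type `(n, n)`. -/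
noncomputable def diagonalDiagrams : Multicategory :=
  evenBoxDiagrams.full fun p : {p : ℕ × ℕ // Even (p.1 + p.2)} => p.1.1 = p.1.2

end PlanarDiagrams

open PlanarDiagrams CategoryTheory

universe u w

/-!
Two objects of a multicategory that are joined by mutually inverse unary morphisms are
interchangeable. Hence two families of objects of one multicategory that meet the same isomorphism
classes span equivalent multicategories; inside the multicategory of diagrams on disks and boxes it
remains to see that bodies with equally many pins are isomorphic. In logarithmic coordinates, the
directions of the spokes of a body are an increasing periodic sequence of angles, and the gauge
becomes a function of the angle up to a translation. A shear `ζ ↦ ζ + w (Im ζ)` with `w` periodic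
therefore matches the spokes and the gauges of two bodies. It descends to a homeomorphism of the
plane, which `ζ ↦ ζ + t * w (Im ζ)` joins to the identity; a half-size copy of one body, placed in
the other one by this homeomorphism and with straight strings, is an invertible diagram.
Finally, restriction along functors turns an equivalence of multicategories into an equivalence of
their categories of representations.
-/

namespace PlanarDiagrams

universe v u' v' u₁ v₁

/-! ### Isomorphic objects of a multicategory -/

theorem finSigma_symm_one_left {d : ℕ} (l : Fin (∑ _ : Fin 1, d)) :
    (finSigmaFinEquiv.symm l).2 = Fin.cast (by simp) l := by
  obtain ⟨⟨i, j⟩, rfl⟩ := finSigmaFinEquiv.surjective l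
  rw [Equiv.symm_apply_apply]
  exact Fin.ext (finSigmaFinEquiv_one _).symm

theorem finSigma_symm_one_right {d : ℕ} (l : Fin (∑ _ : Fin d, 1)) :
    (finSigmaFinEquiv.symm l).1 = Fin.cast (by simp) l := by
  obtain ⟨⟨i, j⟩, rfl⟩ := finSigmaFinEquiv.surjective l
  rw [Equiv.symm_apply_apply]
  obtain rfl : j = 0 := Subsingleton.elim _ _
  exact Fin.ext (finSigma_one d i).symm

namespace Multicategory

section Unary

variable {M : Multicategory.{u, v}}

theorem hom_congr {d d' : ℕ} {X : Fin d → M.Obj} {X' : Fin d' → M.Obj} (hd : d = d')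
    (hX : ∀ i, X i = X' (Fin.cast hd i)) (Y : M.Obj) : M.Hom X Y = M.Hom X' Y := by
  subst hd
  obtain rfl : X = X' := funext hX
  rfl

theorem comp_heq {d d' : ℕ} (hd : d = d') {X : Fin d → M.Obj} {X' : Fin d' → M.Obj}
    (hX : ∀ i, X i = X' (Fin.cast hd i)) {Y : M.Obj} {e : Fin d → ℕ} {e' : Fin d' → ℕ}
    (he : ∀ i, e i = e' (Fin.cast hd i))
    {Z : (i : Fin d) → Fin (e i) → M.Obj} {Z' : (i : Fin d') → Fin (e' i) → M.Obj}
    (hZ : ∀ i j, Z i j = Z' (Fin.cast hd i) (Fin.cast (he i) j))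
    {T : M.Hom X Y} {T' : M.Hom X' Y} (hT : HEq T T')
    {U : (i : Fin d) → M.Hom (Z i) (X i)} {U' : (i : Fin d') → M.Hom (Z' i) (X' i)}
    (hU : ∀ i, HEq (U i) (U' (Fin.cast hd i))) : HEq (M.comp T U) (M.comp T' U') := by
  subst hd
  obtain rfl : X = X' := funext hX
  obtain rfl : e = e' := funext he
  obtain rfl : Z = Z' := funext fun i => funext (hZ i)
  obtain rfl := eq_of_heq hT
  obtain rfl : U = U' := funext fun i => eq_of_heq (hU i)
  rfl

/-- Morphisms with one input. -/
abbrev Unary (M : Multicategory.{u, v}) (X Y : M.Obj) : Type v :=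
  M.Hom (fun _ : Fin 1 => X) Y

variable {d : ℕ} {X X' X'' : Fin d → M.Obj} {Y Y' Y'' : M.Obj} {e : Fin d → ℕ}
  {Z Z' : (i : Fin d) → Fin (e i) → M.Obj}

/-- Composition with a unary morphism at the output, transported so that the inputs of `T` stay
the same by definition. -/
def postcomp (σ : M.Unary Y Y') (T : M.Hom X Y) : M.Hom X Y' :=
  cast (hom_congr (by simp) (fun l => congrArg X (finSigma_symm_one_left l)) Y')
    (M.comp σ fun _ => T)

/-- Composition with unary morphisms at the inputs, transported so that the number of inputs stays
the same by definition. -/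
def precomp (T : M.Hom X Y) (σ : (i : Fin d) → M.Unary (X' i) (X i)) : M.Hom X' Y :=
  cast (hom_congr (by simp) (fun l => congrArg X' (finSigma_symm_one_right l)) Y) (M.comp T σ)

theorem postcomp_heq (σ : M.Unary Y Y') (T : M.Hom X Y) :
    HEq (postcomp σ T) (M.comp σ fun _ => T) :=
  cast_heq _ _

theorem precomp_heq (T : M.Hom X Y) (σ : (i : Fin d) → M.Unary (X' i) (X i)) :
    HEq (precomp T σ) (M.comp T σ) :=
  cast_heq _ _

theorem postcomp_congr_heq {d' : ℕ} {V : Fin d' → M.Obj} (σ : M.Unary Y Y') {T : M.Hom X Y}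
    {U : M.Hom V Y} (hd : d = d') (hX : ∀ i, X i = V (Fin.cast hd i)) (hT : HEq T U) :
    HEq (postcomp σ T) (postcomp σ U) := by
  subst hd
  obtain rfl : X = V := funext hX
  obtain rfl := eq_of_heq hT
  rfl

theorem id_postcomp (T : M.Hom X Y) : postcomp (M.id Y) T = T :=
  eq_of_heq ((postcomp_heq _ _).trans (M.id_comp T))

theorem precomp_id (T : M.Hom X Y) : precomp T (fun i => M.id (X i)) = T :=
  eq_of_heq ((precomp_heq _ _).trans (M.comp_id T))

theorem precomp_eq_postcomp {X Y Z : M.Obj} (σ : M.Unary Y Z) (τ : M.Unary X Y) :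
    precomp σ (fun _ => τ) = postcomp σ τ :=
  eq_of_heq ((precomp_heq _ _).trans (postcomp_heq _ _).symm)

theorem postcomp_comp (σ : M.Unary Y Y') (T : M.Hom X Y) (U : (i : Fin d) → M.Hom (Z i) (X i)) :
    postcomp σ (M.comp T U) = M.comp (postcomp σ T) U := by
  refine eq_of_heq ((postcomp_heq _ _).trans ((M.assoc σ (fun _ => T) (fun _ => U)).symm.trans ?_))
  refine comp_heq (by simp) (fun l => congrArg X (finSigma_symm_one_left l))
    (fun l => congrArg e (finSigma_symm_one_left l)) (fun l j => ?_) (postcomp_heq _ _).symm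
    (fun l => congr_arg_heq U (finSigma_symm_one_left l))
  exact congr_heq (congr_arg_heq Z (finSigma_symm_one_left l))
    (by rw [Fin.heq_ext_iff (congrArg e (finSigma_symm_one_left l))]; rfl)

theorem comp_precomp (T : M.Hom X Y) (σ : (i : Fin d) → M.Unary (X' i) (X i))
    (U : (i : Fin d) → M.Hom (Z i) (X' i)) :
    M.comp (precomp T σ) U = M.comp T (fun i => postcomp (σ i) (U i)) := by
  have assoc : HEq (M.comp (precomp T σ) U) (M.comp T fun i => M.comp (σ i) fun _ => U i) := by
    refine HEq.trans (HEq.symm ?_) (M.assoc T σ (fun i _ => U i))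
    refine comp_heq (by simp) (fun l => congrArg X' (finSigma_symm_one_right l))
      (fun l => congrArg e (finSigma_symm_one_right l)) (fun l j => ?_) (precomp_heq _ _).symm
      (fun l => congr_arg_heq U (finSigma_symm_one_right l))
    exact congr_heq (congr_arg_heq Z (finSigma_symm_one_right l))
      (by rw [Fin.heq_ext_iff (congrArg e (finSigma_symm_one_right l))]; rfl)
  exact eq_of_heq (assoc.trans (comp_heq rfl (fun _ => rfl) (fun i => by simp)
    (fun i j => congrArg (Z i) (finSigma_symm_one_left j)) HEq.rfl
    fun i => (postcomp_heq _ _).symm))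

theorem precomp_comp (T : M.Hom X Y) (U : (i : Fin d) → M.Hom (Z i) (X i))
    (σ : (i : Fin d) → (j : Fin (e i)) → M.Unary (Z' i j) (Z i j)) :
    precomp (X' := concat Z') (M.comp T U)
        (fun k => σ (finSigmaFinEquiv.symm k).1 (finSigmaFinEquiv.symm k).2) =
      M.comp T (fun i => precomp (U i) (σ i)) := by
  refine eq_of_heq ((precomp_heq _ _).trans ((M.assoc T U σ).trans ?_))
  exact comp_heq rfl (fun _ => rfl) (fun i => by simp)
    (fun i j => congrArg (Z' i) (finSigma_symm_one_right j)) HEq.rfl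
    fun i => (precomp_heq _ _).symm

theorem postcomp_precomp (σ : M.Unary Y Y') (T : M.Hom X Y)
    (τ : (i : Fin d) → M.Unary (X' i) (X i)) :
    postcomp σ (precomp T τ) = precomp (postcomp σ T) τ := by
  refine eq_of_heq (HEq.trans ?_ (precomp_heq _ _).symm)
  rw [← postcomp_comp]
  exact postcomp_congr_heq σ (by simp)
    (fun l => congrArg X' (by rw [finSigma_symm_one_right]; rfl)) (precomp_heq _ _)

theorem postcomp_postcomp (σ : M.Unary Y' Y'') (τ : M.Unary Y Y') (T : M.Hom X Y) :
    postcomp σ (postcomp τ T) = postcomp (postcomp σ τ) T := by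
  refine eq_of_heq (HEq.trans ?_ (postcomp_heq _ _).symm)
  rw [← postcomp_comp]
  exact postcomp_congr_heq σ (by simp)
    (fun l => congrArg X (by rw [finSigma_symm_one_left]; rfl)) (postcomp_heq _ _)

theorem precomp_precomp (T : M.Hom X Y) (σ : (i : Fin d) → M.Unary (X' i) (X i))
    (τ : (i : Fin d) → M.Unary (X'' i) (X' i)) :
    precomp (precomp T σ) τ = precomp T (fun i => postcomp (σ i) (τ i)) := by
  refine eq_of_heq ((precomp_heq _ _).trans (HEq.trans ?_ (precomp_heq _ _).symm))
  rw [comp_precomp]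

/-- Two objects are isomorphic through unary morphisms. -/
structure ObjIso (M : Multicategory.{u, v}) (X Y : M.Obj) where
  hom : M.Unary X Y
  inv : M.Unary Y X
  hom_inv : postcomp inv hom = M.id X
  inv_hom : postcomp hom inv = M.id Y

namespace ObjIso

/-- The inverse isomorphism. -/
def symm {X Y : M.Obj} (σ : ObjIso M X Y) : ObjIso M Y X :=
  ⟨σ.inv, σ.hom, σ.inv_hom, σ.hom_inv⟩

/-- The composite isomorphism. -/
def trans {X Y Z : M.Obj} (σ : ObjIso M X Y) (τ : ObjIso M Y Z) : ObjIso M X Z where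
  hom := postcomp τ.hom σ.hom
  inv := postcomp σ.inv τ.inv
  hom_inv := by
    rw [← postcomp_postcomp, postcomp_postcomp τ.inv, τ.hom_inv, id_postcomp, σ.hom_inv]
  inv_hom := by
    rw [← postcomp_postcomp, postcomp_postcomp σ.hom, σ.inv_hom, id_postcomp, τ.inv_hom]

/-- Transport of a morphism along isomorphisms of its inputs and of its output. -/
def conj (σ : (i : Fin d) → ObjIso M (X i) (X' i)) (τ : ObjIso M Y Y') (T : M.Hom X Y) :
    M.Hom X' Y' :=
  postcomp τ.hom (precomp T fun i => (σ i).inv)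

theorem conj_id {X Y : M.Obj} (σ : ObjIso M X Y) : conj (fun _ => σ) σ (M.id X) = M.id Y := by
  rw [conj, precomp_eq_postcomp, id_postcomp, σ.inv_hom]

theorem conj_comp (σ : (i : Fin d) → ObjIso M (X i) (X' i)) (τ : ObjIso M Y Y')
    (ρ : (i : Fin d) → (j : Fin (e i)) → ObjIso M (Z i j) (Z' i j)) (T : M.Hom X Y)
    (U : (i : Fin d) → M.Hom (Z i) (X i)) :
    conj (X' := concat Z')
        (fun k => ρ (finSigmaFinEquiv.symm k).1 (finSigmaFinEquiv.symm k).2) τ (M.comp T U) =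
      M.comp (conj σ τ T) (fun i => conj (ρ i) (σ i) (U i)) := by
  simp only [conj]
  rw [precomp_comp (T := T) (U := U) (σ := fun i j => (ρ i j).inv), ← postcomp_comp, comp_precomp]
  simp only [postcomp_postcomp, (σ _).hom_inv, id_postcomp]

theorem precomp_conj_hom (σ : (i : Fin d) → ObjIso M (X i) (X' i)) (τ : ObjIso M Y Y')
    (T : M.Hom X Y) : precomp (conj σ τ T) (fun i => (σ i).hom) = postcomp τ.hom T := by
  rw [conj, ← postcomp_precomp, precomp_precomp]
  simp only [(σ _).hom_inv, precomp_id]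

theorem postcomp_inv_conj (σ : (i : Fin d) → ObjIso M (X i) (X' i)) (τ : ObjIso M Y Y')
    (T : M.Hom X Y) : postcomp τ.inv (conj σ τ T) = precomp T fun i => (σ i).inv := by
  rw [conj, postcomp_postcomp, τ.hom_inv, id_postcomp]

theorem conj_conj (σ : (i : Fin d) → ObjIso M (X i) (X' i)) (τ : ObjIso M Y Y')
    (σ' : (i : Fin d) → ObjIso M (X' i) (X'' i)) (τ' : ObjIso M Y' Y'') (T : M.Hom X Y) :
    conj σ' τ' (conj σ τ T) = conj (fun i => (σ i).trans (σ' i)) (τ.trans τ') T := by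
  simp only [conj, trans]
  rw [← postcomp_precomp, postcomp_postcomp, precomp_precomp]

end ObjIso

end Unary

/-- The multicategory with objects `O` and with the morphisms of `M` between their images under
`f`. -/
def pullback (M : Multicategory.{u, v}) {O : Type u'} (f : O → M.Obj) : Multicategory.{u', v} where
  Obj := O
  Hom X Y := M.Hom (fun i => f (X i)) (f Y)
  id X := M.id (f X)
  comp T U := M.comp T U
  id_comp T := M.id_comp T
  comp_id T := M.comp_id T
  assoc T U W := M.assoc T U W

section Pullback

variable {M : Multicategory.{u, v}} {O : Type u'} {O' : Type u₁} {f : O → M.Obj} {g : O' → M.Obj}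

/-- The functor that is conjugation by the isomorphisms `σ` on morphisms. -/
def pullbackFunctor (s : O → O') (σ : (a : O) → ObjIso M (f a) (g (s a))) :
    MFunctor (M.pullback f) (M.pullback g) where
  obj := s
  map {_ X Y} T := ObjIso.conj (M := M) (fun i => σ (X i)) (σ Y) T
  map_id X := ObjIso.conj_id (σ X)
  map_comp {_ X Y _ Z} T U :=
    ObjIso.conj_comp (fun i => σ (X i)) (σ Y) (fun i j => σ (Z i j)) T U

theorem pullbackFunctor_comp (s : O → O') (σ : (a : O) → ObjIso M (f a) (g (s a)))
    (t : O' → O) (τ : (b : O') → ObjIso M (g b) (f (t b))) :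
    (pullbackFunctor s σ).comp (pullbackFunctor t τ) =
      pullbackFunctor (fun a => t (s a)) fun a => (σ a).trans (τ (s a)) := by
  simp only [MFunctor.comp, pullbackFunctor]
  congr 1
  funext d X Y T
  exact ObjIso.conj_conj _ _ _ _ _

/-- An endofunctor that is conjugation by isomorphisms is naturally equivalent to the identity. -/
def pullbackFunctorIso (s : O → O) (σ : (a : O) → ObjIso M (f a) (f (s a))) :
    MNatIso (pullbackFunctor s σ) (MFunctor.id (M.pullback f)) where
  hom :=
    { app := fun X => (σ X).inv
      naturality := fun {_ X Y} T => (postcomp_heq _ _).symm.trans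
        ((heq_of_eq (ObjIso.postcomp_inv_conj (fun i => σ (X i)) (σ Y) T)).trans
          (precomp_heq _ _)) }
  inv :=
    { app := fun X => (σ X).hom
      naturality := fun {_ X Y} T => (postcomp_heq _ _).symm.trans
        ((heq_of_eq (ObjIso.precomp_conj_hom (fun i => σ (X i)) (σ Y) T).symm).trans
          (precomp_heq _ _)) }
  hom_inv X := (postcomp_heq (σ X).hom (σ X).inv).symm.trans (heq_of_eq (σ X).inv_hom)
  inv_hom X := (postcomp_heq (σ X).inv (σ X).hom).symm.trans (heq_of_eq (σ X).hom_inv)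

theorem pullback_equivalent (hfg : ∀ a, ∃ b, Nonempty (ObjIso M (f a) (g b)))
    (hgf : ∀ b, ∃ a, Nonempty (ObjIso M (g b) (f a))) :
    (M.pullback f).Equivalent (M.pullback g) := by
  choose s hs using hfg
  choose t ht using hgf
  refine ⟨pullbackFunctor s fun a => (hs a).some, pullbackFunctor t fun b => (ht b).some, ?_, ?_⟩
  all_goals
    rw [pullbackFunctor_comp]
    exact ⟨pullbackFunctorIso _ _⟩

end Pullback

end Multicategory

/-! ### Restriction of representations -/

open Multicategory

section MapComp

variable {M : Multicategory.{u, v}} {N : Multicategory.{u', v'}} {d : ℕ} {X X' : Fin d → M.Obj}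
  {Y Y' : M.Obj}

theorem MFunctor.map_heq (F : MFunctor M N) {d' : ℕ} {V : Fin d' → M.Obj} (hd : d = d')
    (hX : ∀ i, X i = V (Fin.cast hd i)) {T : M.Hom X Y} {U : M.Hom V Y} (hT : HEq T U) :
    HEq (F.map T) (F.map U) := by
  subst hd
  obtain rfl : X = V := funext hX
  obtain rfl := eq_of_heq hT
  rfl

theorem MFunctor.map_postcomp (F : MFunctor M N) (σ : M.Unary Y Y') (T : M.Hom X Y) :
    F.map (postcomp σ T) = postcomp (F.map σ) (F.map T) := by
  refine eq_of_heq (HEq.trans ?_ (postcomp_heq _ _).symm)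
  rw [← F.map_comp σ (fun _ => T)]
  exact F.map_heq (V := concat fun _ => X) (by simp)
    (fun l => congrArg X (by rw [finSigma_symm_one_left]; rfl)) (postcomp_heq _ _)

theorem MFunctor.map_precomp (F : MFunctor M N) (T : M.Hom X Y)
    (σ : (i : Fin d) → M.Unary (X' i) (X i)) :
    F.map (precomp T σ) = precomp (X' := fun i => F.obj (X' i)) (F.map T) fun i => F.map (σ i) := by
  refine eq_of_heq (HEq.trans ?_ (precomp_heq _ _).symm)
  rw [← F.map_comp T σ]
  exact F.map_heq (V := concat fun i _ => X' i) (by simp)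
    (fun l => congrArg X' (by rw [finSigma_symm_one_right]; rfl)) (precomp_heq _ _)

theorem MNatTrans.postcomp_app {F G : MFunctor M N} (α : MNatTrans F G) (T : M.Hom X Y) :
    postcomp (α.app Y) (F.map T) = precomp (G.map T) fun i => α.app (X i) :=
  eq_of_heq ((postcomp_heq _ _).trans ((α.naturality T).trans (precomp_heq _ _).symm))

end MapComp

section Representations

variable {k : Type u} [Field k]

/-- The linear map of a multilinear map in one variable. -/
def unaryLinear {X Y : ModuleCat.{w} k} (σ : (MVec.{u, w} k).Unary X Y) : X →ₗ[k] Y :=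
  (MultilinearMap.ofSubsingleton k X Y (0 : Fin 1)).symm σ

theorem MVec_postcomp {d : ℕ} {X : Fin d → ModuleCat.{w} k} {Y Y' : ModuleCat.{w} k}
    (σ : (MVec.{u, w} k).Unary Y Y') (T : MultilinearMap k (fun i => X i) Y) :
    postcomp (M := MVec.{u, w} k) (X := X) σ T = (unaryLinear σ).compMultilinearMap T := by
  refine eq_of_heq ((postcomp_heq (M := MVec.{u, w} k) (X := X) σ T).trans ?_)
  refine multilinear_heq k (by simp) (fun l => congrArg X (finSigma_symm_one_left l)) _ _
    fun x x' h => ?_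
  refine (multilinearComp_apply (Z := fun _ => X) σ (fun _ => T) x (fun _ j => x' j)
    fun i j => ?_).trans rfl
  obtain rfl : i = 0 := Subsingleton.elim _ _
  have position : (finSigmaFinEquiv ⟨0, j⟩ : Fin (∑ _ : Fin 1, d)) = Fin.cast (by simp) j :=
    Fin.ext (by rw [finSigmaFinEquiv_one]; rfl)
  rw [position]
  exact (h _).symm

theorem MVec_precomp {d : ℕ} {X X' : Fin d → ModuleCat.{w} k} {Y : ModuleCat.{w} k}
    (T : MultilinearMap k (fun i => X i) Y) (σ : (i : Fin d) → (MVec.{u, w} k).Unary (X' i) (X i)) :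
    precomp (M := MVec.{u, w} k) (X' := X') (Y := Y) T σ =
      T.compLinearMap fun i => unaryLinear (σ i) := by
  refine eq_of_heq ((precomp_heq (M := MVec.{u, w} k) (X' := X') (Y := Y) T σ).trans ?_)
  refine multilinear_heq k (by simp) (fun l => congrArg X' (finSigma_symm_one_right l)) _ _
    fun x x' h => ?_
  refine (multilinearComp_apply (Z := fun i _ => X' i) T σ x (fun i _ => x' i)
    fun i j => ?_).trans rfl
  obtain rfl : j = 0 := Subsingleton.elim _ _
  have position : Fin.cast (by simp) (finSigmaFinEquiv ⟨i, 0⟩ : Fin (∑ _ : Fin d, 1)) = i :=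
    Fin.ext (finSigma_one d i)
  refine HEq.trans ?_ (h _).symm
  rw [position]

namespace MRep

variable {M : Multicategory.{u', v'}} {N : Multicategory.{u₁, v₁}}

theorem act_postcomp (V : MRep.{u, u', v', w} k M) {d : ℕ} {X : Fin d → M.Obj} {Y Y' : M.Obj}
    (σ : M.Unary Y Y') (T : M.Hom X Y) (x : ∀ i, V.space (X i)) :
    V.act (postcomp σ T) x = V.act σ (fun _ => V.act T x) :=
  congrArg (fun S : MultilinearMap k (fun i => V.space (X i)) (V.space Y') => S x)
    ((MFunctor.map_postcomp V σ T).trans (MVec_postcomp (V.act σ) (V.act T)))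

theorem act_precomp (V : MRep.{u, u', v', w} k M) {d : ℕ} {X X' : Fin d → M.Obj} {Y : M.Obj}
    (T : M.Hom X Y) (σ : (i : Fin d) → M.Unary (X' i) (X i)) (x : ∀ i, V.space (X' i)) :
    V.act (precomp T σ) x = V.act T (fun i => V.act (σ i) (fun _ => x i)) :=
  congrArg (fun S : MultilinearMap k (fun i => V.space (X' i)) (V.space Y) => S x)
    ((MFunctor.map_precomp V T σ).trans
      (MVec_precomp (X' := fun i => V.space (X' i)) (V.act T) (fun i => V.act (σ i))))

theorem act_id (V : MRep.{u, u', v', w} k M) (X : M.Obj) (x : V.space X) :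
    V.act (M.id X) (fun _ => x) = x :=
  congrArg (fun S : MultilinearMap k (fun _ : Fin 1 => V.space X) (V.space X) => S fun _ => x)
    (V.map_id X)

theorem hom_ext {V W : MRep.{u, u', v', w} k M} {φ ψ : V ⟶ W}
    (h : ∀ X x, φ.app X x = ψ.app X x) : φ = ψ :=
  Intertwiner.ext (funext fun X => LinearMap.ext (h X))

/-- Restriction of representations along a functor. -/
def restrict (F : MFunctor M N) : MRep.{u, u₁, v₁, w} k N ⥤ MRep.{u, u', v', w} k M where
  obj V := MFunctor.comp F V
  map φ := { app := fun X => φ.app (F.obj X), comm := fun T x => φ.comm (F.map T) x }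

/-- The intertwiner of restricted representations given by a natural transformation. -/
def restrictHom {F G : MFunctor M N} (α : MNatTrans F G) (V : MRep.{u, u₁, v₁, w} k N) :
    (restrict F).obj V ⟶ (restrict G).obj V where
  app X := unaryLinear (V.act (α.app X))
  comm T x := (V.act_postcomp _ _ x).symm.trans
    ((congrArg (fun S => V.act S x) (α.postcomp_app T)).trans (V.act_precomp _ _ x))

theorem restrictHom_comp_restrictHom {F G : MFunctor M N} (α : MNatTrans F G) (β : MNatTrans G F)
    (h : ∀ X, HEq (N.comp (β.app X) fun _ => α.app X) (N.id (F.obj X)))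
    (V : MRep.{u, u₁, v₁, w} k N) : restrictHom α V ≫ restrictHom β V = 𝟙 _ :=
  hom_ext fun X x => (V.act_postcomp (β.app X) (α.app X) fun _ => x).symm.trans <| by
    rw [eq_of_heq ((postcomp_heq _ _).trans (h X))]
    exact V.act_id _ x

/-- Naturally equivalent functors have isomorphic restriction functors. -/
def restrictIso {F G : MFunctor M N} (α : MNatIso F G) :
    (restrict F : MRep.{u, u₁, v₁, w} k N ⥤ _) ≅ restrict G :=
  NatIso.ofComponents
    (fun V =>
      { hom := restrictHom α.hom V
        inv := restrictHom α.inv V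
        hom_inv_id := restrictHom_comp_restrictHom α.hom α.inv α.hom_inv V
        inv_hom_id := restrictHom_comp_restrictHom α.inv α.hom α.inv_hom V })
    fun φ => hom_ext fun X x => (φ.comm (α.hom.app X) fun _ => x).symm

end MRep

theorem Multicategory.Equivalent.mRep {M : Multicategory.{u', v'}} {N : Multicategory.{u₁, v₁}}
    (h : M.Equivalent N) : Nonempty (MRep.{u, u', v', w} k M ≌ MRep.{u, u₁, v₁, w} k N) := by
  obtain ⟨F, G, ⟨α⟩, ⟨β⟩⟩ := h
  exact ⟨CategoryTheory.Equivalence.mk (MRep.restrict G) (MRep.restrict F)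
    (MRep.restrictIso β).symm (MRep.restrictIso α)⟩

end Representations
/-! ### Isomorphic bodies -/

open Set Filter
open scoped Topology unitInterval

theorem IsotopicToId.symm {φ : ℂ ≃ₜ ℂ} (h : IsotopicToId φ) : IsotopicToId φ.symm := by
  obtain ⟨H, hH⟩ := h
  refine ⟨H.symm, fun z => ?_⟩
  obtain ⟨w, rfl⟩ := φ.surjective z
  rw [φ.symm_apply_apply, ← hH, H.eval_symm_eval]

/-- Isomorphisms of pinned bodies: positively homogeneous, orientation-preserving homeomorphisms
of the plane that carry one body to the other, and its pins to the pins of the other, in terms of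
gauges and spokes. The numbering of the pins need not be respected. -/
structure BodyIso (X Y : PinnedBody) where
  toHomeo : ℂ ≃ₜ ℂ
  orientation : IsotopicToId toHomeo
  map_smul : ∀ (t : ℝ) (z : ℂ), 0 < t → toHomeo (t • z) = t • toHomeo z
  gauge_eq : ∀ z, Y.gauge (toHomeo z) = X.gauge z
  mem_spokes : ∀ z, toHomeo z ∈ Y.spokes ↔ z ∈ X.spokes

namespace BodyIso

variable {X Y : PinnedBody}

/-- The inverse of an isomorphism of bodies. -/
noncomputable def symm (φ : BodyIso X Y) : BodyIso Y X where
  toHomeo := φ.toHomeo.symm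
  orientation := φ.orientation.symm
  map_smul t z ht := by
    rw [Homeomorph.symm_apply_eq, φ.map_smul _ _ ht, φ.toHomeo.apply_symm_apply]
  gauge_eq z := by rw [← φ.gauge_eq, φ.toHomeo.apply_symm_apply]
  mem_spokes z := by rw [← φ.mem_spokes, φ.toHomeo.apply_symm_apply]

theorem map_half (φ : BodyIso X Y) (z : ℂ) :
    φ.toHomeo (Diagram.half z) = Diagram.half (φ.toHomeo z) :=
  φ.map_smul _ _ one_half_pos

theorem image_ident_strings (φ : BodyIso X Y) :
    φ.toHomeo '' (Diagram.ident X).strings = (Diagram.ident Y).strings := by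
  ext w
  obtain ⟨z, rfl⟩ := φ.toHomeo.surjective w
  rw [φ.toHomeo.injective.mem_set_image]
  change (z ∈ X.spokes ∧ _ ≤ X.gauge z ∧ X.gauge z ≤ _) ↔
    (φ.toHomeo z ∈ Y.spokes ∧ _ ≤ Y.gauge (φ.toHomeo z) ∧ Y.gauge (φ.toHomeo z) ≤ _)
  rw [φ.mem_spokes, φ.gauge_eq]

end BodyIso

/-- The image of a diagram under an isomorphism of its outer body. -/
noncomputable def Diagram.mapOuter {ι : Type} {X : ι → PinnedBody} {Y Y' : PinnedBody}
    (T : Diagram X Y) (φ : BodyIso Y Y') : Diagram X Y' where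
  place i := (T.place i).trans φ.toHomeo
  place_orientation i := (T.place_orientation i).trans φ.orientation
  place_interior i z hz := by
    rw [Homeomorph.trans_apply, φ.gauge_eq]
    exact T.place_interior i z hz
  place_disjoint i j hij := by
    change Disjoint ((φ.toHomeo ∘ T.place i) '' _) ((φ.toHomeo ∘ T.place j) '' _)
    rw [image_comp, image_comp]
    exact (disjoint_image_iff φ.toHomeo.injective).2 (T.place_disjoint i j hij)
  strings := φ.toHomeo '' T.strings
  strings_closed := φ.toHomeo.isClosedMap _ T.strings_closed
  strings_subset := by
    rintro _ ⟨z, hz, rfl⟩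
    exact (φ.gauge_eq z).trans_le (T.strings_subset hz)
  strings_avoid i z hz h :=
    T.strings_avoid i z hz (φ.toHomeo.injective.mem_set_image.1 h)
  strings_manifold := by
    rintro _ ⟨z, hz, rfl⟩ interior outside
    rw [φ.gauge_eq] at interior
    refine (T.strings_manifold z hz interior ?_).image φ.toHomeo
    rintro i ⟨x, hx, rfl⟩
    exact outside i ⟨x, hx, rfl⟩
  strings_outer := by
    obtain ⟨r, hr, h⟩ := T.strings_outer
    refine ⟨r, hr, fun w => ?_⟩
    obtain ⟨z, rfl⟩ := φ.toHomeo.surjective w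
    rw [φ.gauge_eq, φ.mem_spokes, φ.toHomeo.injective.mem_set_image]
    exact h z
  strings_inner i := by
    obtain ⟨r, hr, h⟩ := T.strings_inner i
    refine ⟨r, hr, fun z h₁ h₂ => ?_⟩
    rw [Homeomorph.trans_apply, φ.toHomeo.injective.mem_set_image]
    exact h z h₁ h₂

namespace BodyIso

variable {X Y : PinnedBody}

/-- The diagram in `Y` with one inner body, a half-size copy of `X` that is placed by `φ`, and
straight strings. -/
noncomputable def diagram (φ : BodyIso X Y) : Diagram (fun _ : Fin 1 => X) Y :=
  (Diagram.ident X).mapOuter φ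

theorem plugClass_diagram_symm (φ : BodyIso X Y) :
    HEq (Diagram.plugClass (Quotient.mk (Diagram.setoid _ _) φ.symm.diagram)
        (fun _ => Quotient.mk (Diagram.setoid _ _) φ.diagram))
      (Quotient.mk (Diagram.setoid _ _) (Diagram.ident X)) := by
  refine HEq.trans (heq_of_eq ?_)
    (Diagram.ident_plugClass (Quotient.mk (Diagram.setoid _ _) (Diagram.ident X)))
  rw [Diagram.plugClass_mk, Diagram.plugClass_mk]
  have cancel (z : ℂ) :
      φ.toHomeo.symm (Diagram.half (φ.toHomeo z)) = Diagram.half z := by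
    rw [← φ.map_half, φ.toHomeo.symm_apply_apply]
  refine Quotient.sound ⟨PlaneIsotopy.refl, fun _ _ _ => rfl, fun _ z _ => cancel _, ?_⟩
  have eval_refl : PlaneIsotopy.refl.eval 1 = _root_.id := rfl
  rw [eval_refl, image_id]
  change φ.symm.toHomeo '' (Diagram.ident Y).strings ∪
      ⋃ _ : Fin 1, Diagram.half.trans φ.toHomeo.symm '' (φ.toHomeo '' (Diagram.ident X).strings) =
    (Diagram.ident X).strings ∪ ⋃ _ : Fin 1, Diagram.half '' (Diagram.ident X).strings
  simp only [φ.symm.image_ident_strings, image_image, Homeomorph.trans_apply, cancel]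

/-- Isomorphic bodies are isomorphic objects of the multicategory of diagrams. -/
noncomputable def objIso {O : Type} {B : O → PinnedBody} {a b : O} (φ : BodyIso (B a) (B b)) :
    ObjIso (diagrams B) a b where
  hom := Quotient.mk (Diagram.setoid _ _) φ.diagram
  inv := Quotient.mk (Diagram.setoid _ _) φ.symm.diagram
  hom_inv := eq_of_heq ((postcomp_heq _ _).trans φ.plugClass_diagram_symm)
  inv_hom := eq_of_heq ((postcomp_heq _ _).trans φ.symm.plugClass_diagram_symm)

end BodyIso
/-! ### Matching of periodic sequences -/

/-- The piecewise linear function on the line that extends a sequence indexed by the integers. -/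
noncomputable def interp (a : ℤ → ℝ) (x : ℝ) : ℝ := a ⌊x⌋ + Int.fract x * (a (⌊x⌋ + 1) - a ⌊x⌋)

theorem interp_intCast_add (a : ℤ → ℝ) (k : ℤ) {s : ℝ} (hs : s ∈ Ico 0 1) :
    interp a (k + s) = a k + s * (a (k + 1) - a k) := by
  have floor_eq : ⌊(k : ℝ) + s⌋ = k := by
    rw [Int.floor_intCast_add, Int.floor_eq_zero_iff.2 hs, add_zero]
  rw [interp, Int.fract, floor_eq, add_sub_cancel_left]

theorem interp_intCast (a : ℤ → ℝ) (k : ℤ) : interp a k = a k := by simp [interp]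

theorem interp_add_natCast {a : ℤ → ℝ} {n : ℕ} {P : ℝ} (ha : ∀ k, a (k + n) = a k + P) (x : ℝ) :
    interp a (x + n) = interp a x + P := by
  rw [interp, interp, Int.floor_add_natCast, Int.fract_add_natCast, add_right_comm, ha, ha]
  ring

theorem interp_strictMono {a : ℤ → ℝ} (ha : StrictMono a) : StrictMono (interp a) := by
  have step_pos (k : ℤ) : 0 < a (k + 1) - a k := sub_pos.2 (ha (lt_add_one k))
  intro x y hxy
  rcases (Int.floor_mono hxy.le).eq_or_lt with same_floor | floor_lt
  · have fract_lt : Int.fract x < Int.fract y := by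
      rw [Int.fract, Int.fract, same_floor]
      linarith
    rw [interp, interp, same_floor]
    gcongr
    exact step_pos _
  · calc interp a x < a ⌊x⌋ + 1 * (a (⌊x⌋ + 1) - a ⌊x⌋) := by
          rw [interp]
          gcongr
          exacts [step_pos _, Int.fract_lt_one x]
      _ = a (⌊x⌋ + 1) := by ring
      _ ≤ a ⌊y⌋ := ha.monotone floor_lt
      _ ≤ interp a y := le_add_of_nonneg_right (mul_nonneg (Int.fract_nonneg y) (step_pos _).le)

theorem exists_mem_Ico_of_periodic {a : ℤ → ℝ} (ha : StrictMono a) {n : ℕ} {P : ℝ} (hP : 0 < P)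
    (hper : ∀ k, a (k + n) = a k + P) (x : ℝ) : ∃ m, x ∈ Ico (a m) (a (m + 1)) := by
  have apply_mul (q : ℤ) : a (q * n) = a 0 + q * P := by
    simpa using AddConstMapClass.map_add_zsmul (⟨a, hper⟩ : AddConstMap ℤ ℝ (n : ℤ) P) 0 q
  obtain ⟨m, hm, greatest⟩ : ∃ m : ℤ, a m ≤ x ∧ ∀ k, a k ≤ x → k ≤ m := by
    refine Int.exists_greatest_of_bdd ⟨⌈(x - a 0) / P⌉ * n, fun k hk => ?_⟩
      ⟨⌊(x - a 0) / P⌋ * n, ?_⟩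
    · refine ha.le_iff_le.1 (hk.trans ?_)
      rw [apply_mul, ← sub_le_iff_le_add', ← div_le_iff₀ hP]
      exact Int.le_ceil _
    · rw [apply_mul, ← le_sub_iff_add_le', ← le_div_iff₀ hP]
      exact Int.floor_le _
  exact ⟨m, hm, not_le.1 fun h => (lt_add_one m).not_ge (greatest _ h)⟩

theorem interp_surjective {a : ℤ → ℝ} (ha : StrictMono a) {n : ℕ} {P : ℝ} (hP : 0 < P)
    (hper : ∀ k, a (k + n) = a k + P) : Function.Surjective (interp a) := by
  intro x
  obtain ⟨m, hle, hlt⟩ := exists_mem_Ico_of_periodic ha hP hper x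
  have step_pos : 0 < a (m + 1) - a m := sub_pos.2 (ha (lt_add_one m))
  refine ⟨m + (x - a m) / (a (m + 1) - a m), ?_⟩
  rw [interp_intCast_add _ _ ⟨by bound, (div_lt_one step_pos).2 (by linarith)⟩,
    div_mul_cancel₀ _ step_pos.ne', add_sub_cancel]

theorem exists_orderIso_of_periodic {a b : ℤ → ℝ} (ha : StrictMono a) (hb : StrictMono b) {n : ℕ}
    {P : ℝ} (hP : 0 < P) (hpa : ∀ k, a (k + n) = a k + P) (hpb : ∀ k, b (k + n) = b k + P) :
    ∃ θ : ℝ ≃o ℝ, (∀ x, θ (x + P) = θ x + P) ∧ ∀ k, θ (a k) = b k := by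
  let α := StrictMono.orderIsoOfSurjective _ (interp_strictMono ha) (interp_surjective ha hP hpa)
  let β := StrictMono.orderIsoOfSurjective _ (interp_strictMono hb) (interp_surjective hb hP hpb)
  have hθ (x : ℝ) : (α.symm.trans β) (interp a x) = interp b x :=
    congrArg β (α.symm_apply_apply x)
  refine ⟨α.symm.trans β, fun x => ?_, fun k => ?_⟩
  · obtain ⟨y, rfl⟩ := α.surjective x
    change (α.symm.trans β) (interp a y + P) = (α.symm.trans β) (interp a y) + P
    rw [← interp_add_natCast hpa, hθ, hθ, interp_add_natCast hpb]
  · rw [← interp_intCast a, hθ, interp_intCast]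

/-- The sequence indexed by the integers that consists of the translates of a finite sequence by
the integral multiples of `P`, one translate after the other. -/
noncomputable def periodicExtension {n : ℕ} [NeZero n] (s : Fin n → ℝ) (P : ℝ) (k : ℤ) : ℝ :=
  s (Int.divModEquiv n k).2 + (Int.divModEquiv n k).1 * P

section periodicExtension

variable {n : ℕ} [NeZero n] {s : Fin n → ℝ} {P : ℝ}

theorem periodicExtension_apply (q : ℤ) (i : Fin n) :
    periodicExtension s P (q * n + i) = s i + q * P := by
  have h : Int.divModEquiv n (q * n + i) = (q, i) := (Int.divModEquiv n).right_inv (q, i)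
  rw [periodicExtension, h]

theorem exists_eq_mul_add_fin (n : ℕ) [NeZero n] (k : ℤ) :
    ∃ (q : ℤ) (i : Fin n), k = q * n + i :=
  ⟨_, _, ((Int.divModEquiv n).left_inv k).symm⟩

theorem periodicExtension_add_natCast (k : ℤ) :
    periodicExtension s P (k + n) = periodicExtension s P k + P := by
  obtain ⟨q, i, rfl⟩ := exists_eq_mul_add_fin n k
  have shift : q * n + i + n = (q + 1) * n + (i : ℤ) := by ring
  rw [shift, periodicExtension_apply, periodicExtension_apply]
  push_cast
  ring

theorem mem_range_periodicExtension {x : ℝ} :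
    x ∈ range (periodicExtension s P) ↔ ∃ i, ∃ m : ℤ, x = s i + m * P := by
  constructor
  · rintro ⟨k, rfl⟩
    exact ⟨_, _, rfl⟩
  · rintro ⟨i, m, rfl⟩
    exact ⟨_, periodicExtension_apply m i⟩

theorem periodicExtension_strictMono (hs : StrictMono s) (hP : ∀ i j, s i < s j + P) :
    StrictMono (periodicExtension s P) := by
  intro k l hkl
  obtain ⟨q, i, rfl⟩ := exists_eq_mul_add_fin n k
  obtain ⟨r, j, rfl⟩ := exists_eq_mul_add_fin n l
  rw [periodicExtension_apply, periodicExtension_apply]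
  rcases lt_trichotomy q r with hqr | rfl | hrq
  · have P_pos : 0 < P := pos_of_lt_add_right (hP i i)
    have succ_le : (q : ℝ) + 1 ≤ r := by exact_mod_cast hqr
    calc s i + q * P < s j + P + q * P := by gcongr; exact hP i j
      _ = s j + (q + 1) * P := by ring
      _ ≤ s j + r * P := by gcongr
  · have hij : i < j := by
      rw [Fin.lt_def]
      omega
    gcongr
    exact hs hij
  · exfalso
    have : (r + 1) * n ≤ q * n := by gcongr; exact hrq
    have := i.is_lt
    have := j.is_lt
    linarith

end periodicExtension

/-! ### Directions of the spokes -/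

namespace PinnedBody

theorem pin_ne_zero (X : PinnedBody) (p : X.Pin) : X.pin p ≠ 0 := by
  intro h
  have gauge_pin := X.gauge_pin p
  rw [h, X.gauge_zero] at gauge_pin
  exact zero_ne_one gauge_pin

theorem zero_notMem_spokes (X : PinnedBody) : (0 : ℂ) ∉ X.spokes := by
  rintro ⟨p, t, ht, h⟩
  exact (smul_ne_zero ht.ne' (X.pin_ne_zero p)) h.symm

theorem mem_spokes_iff_arg (X : PinnedBody) {z : ℂ} (hz : z ≠ 0) :
    z ∈ X.spokes ↔ ∃ p, z.arg = (X.pin p).arg := by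
  constructor
  · rintro ⟨p, t, ht, rfl⟩
    exact ⟨p, by rw [Complex.real_smul, Complex.arg_real_mul _ ht]⟩
  · rintro ⟨p, hp⟩
    obtain ⟨t, ht, h⟩ := (Complex.sameRay_of_arg_eq hp).exists_pos_right hz (X.pin_ne_zero p)
    exact ⟨p, t, ht, h⟩

theorem arg_pin_injective (X : PinnedBody) : Function.Injective fun p => (X.pin p).arg := by
  intro p q h
  obtain ⟨t, ht, smul_pin⟩ :=
    (Complex.sameRay_of_arg_eq h).exists_pos_left (X.pin_ne_zero p) (X.pin_ne_zero q)
  have t_eq_one : t = 1 := by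
    simpa only [X.gauge_smul _ _ ht.le, X.gauge_pin, mul_one] using congrArg X.gauge smul_pin
  exact X.pin_injective (by rw [← smul_pin, t_eq_one, one_smul])

theorem exp_mem_spokes (X : PinnedBody) (x : ℝ) : Complex.exp (x * Complex.I) ∈ X.spokes ↔
    ∃ p, ∃ m : ℤ, x = (X.pin p).arg + m * (2 * Real.pi) := by
  rw [X.mem_spokes_iff_arg (Complex.exp_ne_zero _)]
  refine exists_congr fun p => ?_
  have arg_mem : (X.pin p).arg ∈ Ioc (-Real.pi) (-Real.pi + 2 * Real.pi) := by
    rw [two_mul, neg_add_cancel_left]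
    exact Complex.arg_mem_Ioc _
  simp only [Complex.arg_exp_mul_I, toIocMod_eq_iff, arg_mem, true_and, zsmul_eq_mul]

theorem exists_angles (X : PinnedBody) [Nonempty X.Pin] : ∃ a : ℤ → ℝ, StrictMono a ∧
    (∀ k, a (k + Nat.card X.Pin) = a k + 2 * Real.pi) ∧
    ∀ x : ℝ, Complex.exp (x * Complex.I) ∈ X.spokes ↔ x ∈ range a := by
  classical
  have := X.finite_pin
  have := Fintype.ofFinite X.Pin
  have : NeZero (Nat.card X.Pin) := ⟨Nat.card_pos.ne'⟩
  let S : Finset ℝ := Finset.univ.image fun p => (X.pin p).arg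
  have card_S : S.card = Nat.card X.Pin := by
    rw [Finset.card_image_of_injective _ X.arg_pin_injective, Finset.card_univ,
      Nat.card_eq_fintype_card]
  let s := S.orderEmbOfFin card_S
  have range_s : range s = range fun p => (X.pin p).arg := by
    rw [Finset.range_orderEmbOfFin, Finset.coe_image, Finset.coe_univ, image_univ]
  have s_mem (i) : s i ∈ Ioc (-Real.pi) Real.pi := by
    obtain ⟨p, hp⟩ := range_s ▸ mem_range_self (f := s) i
    exact hp ▸ Complex.arg_mem_Ioc _
  refine ⟨periodicExtension s (2 * Real.pi), periodicExtension_strictMono s.strictMono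
    fun i j => ?_, periodicExtension_add_natCast, fun x => ?_⟩
  · linarith [(s_mem i).2, (s_mem j).1]
  · rw [X.exp_mem_spokes, mem_range_periodicExtension,
      ← exists_range_iff (f := s) (p := fun y => ∃ m : ℤ, x = y + m * (2 * Real.pi)), range_s,
      exists_range_iff]

theorem exists_matching (X Y : PinnedBody) (h : Nat.card X.Pin = Nat.card Y.Pin) :
    ∃ θ : ℝ ≃o ℝ, (∀ x, θ (x + 2 * Real.pi) = θ x + 2 * Real.pi) ∧
      ∀ x : ℝ, Complex.exp (θ x * Complex.I) ∈ Y.spokes ↔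
        Complex.exp (x * Complex.I) ∈ X.spokes := by
  have := X.finite_pin
  have := Y.finite_pin
  obtain ⟨e⟩ := Finite.card_eq.1 h
  rcases isEmpty_or_nonempty X.Pin with _ | _
  · have := e.symm.isEmpty
    exact ⟨OrderIso.refl ℝ, fun _ => rfl, fun x =>
      ⟨fun ⟨p, _⟩ => isEmptyElim p, fun ⟨p, _⟩ => isEmptyElim p⟩⟩
  · have := e.symm.nonempty
    obtain ⟨a, ha, hpa, hxa⟩ := X.exists_angles
    obtain ⟨b, hb, hpb, hxb⟩ := Y.exists_angles
    obtain ⟨θ, h1, h2⟩ := exists_orderIso_of_periodic ha hb Real.two_pi_pos hpa (h ▸ hpb)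
    refine ⟨θ, h1, fun x => ?_⟩
    simp only [hxa, hxb, mem_range, ← h2, θ.injective.eq_iff]

end PinnedBody

/-! ### Isotopies through bijections -/

namespace PlaneIsotopy

theorem isProperMap_of_le_norm {f : I → ℂ → ℂ} (hf : Continuous fun x : I × ℂ => f x.1 x.2)
    {c : ℝ} (hc : 0 < c) (hle : ∀ t z, c * ‖z‖ ≤ ‖f t z‖) :
    IsProperMap fun x : I × ℂ => (x.1, f x.1 x.2) := by
  have continuous : Continuous fun x : I × ℂ => (x.1, f x.1 x.2) := continuous_fst.prodMk hf
  refine isProperMap_iff_isCompact_preimage.2 ⟨continuous, fun K hK => ?_⟩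
  obtain ⟨R, hR⟩ := (hK.image continuous_snd).isBounded.exists_norm_le
  refine (isCompact_univ.prod (isCompact_closedBall (0 : ℂ) (R / c))).of_isClosed_subset
    (hK.isClosed.preimage continuous) ?_
  rintro ⟨t, z⟩ hz
  refine ⟨mem_univ _, ?_⟩
  rw [mem_closedBall_zero_iff, le_div_iff₀' hc]
  exact (hle t z).trans (hR _ ⟨_, hz, rfl⟩)

/-- The isotopy formed by a continuous family of bijections of the plane that starts at the
identity. The lower bound on the norm makes the family proper, so that its inverse is
continuous. -/
noncomputable def ofBijective (f : I → ℂ → ℂ) (hf : Continuous fun x : I × ℂ => f x.1 x.2)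
    (hbij : ∀ t, Function.Bijective (f t)) (h0 : ∀ z, f 0 z = z) {c : ℝ} (hc : 0 < c)
    (hle : ∀ t z, c * ‖z‖ ≤ ‖f t z‖) : PlaneIsotopy where
  toHomeo := ((Equiv.sigmaEquivProd I ℂ).symm.trans ((Equiv.sigmaCongrRight fun t =>
    Equiv.ofBijective (f t) (hbij t)).trans (Equiv.sigmaEquivProd I ℂ))
    ).toHomeomorphOfContinuousClosed (continuous_fst.prodMk hf)
      (isProperMap_of_le_norm hf hc hle).isClosedMap
  fst_eq _ := rfl
  start z := Prod.ext rfl (h0 z)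

theorem continuous_eval (H : PlaneIsotopy) (t : I) : Continuous (H.eval t) :=
  continuous_snd.comp (H.toHomeo.continuous.comp (Continuous.prodMk_right t))

/-- The homeomorphism at the end of an isotopy. -/
noncomputable def final (H : PlaneIsotopy) : ℂ ≃ₜ ℂ where
  toFun := H.eval 1
  invFun := H.symm.eval 1
  left_inv := H.eval_symm_eval 1
  right_inv := H.eval_eval_symm 1
  continuous_toFun := H.continuous_eval 1
  continuous_invFun := H.symm.continuous_eval 1

theorem final_isotopicToId (H : PlaneIsotopy) : IsotopicToId H.final :=
  ⟨H, fun _ => rfl⟩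

end PlaneIsotopy

/-! ### Twists of the plane -/

/-- The map of the plane that multiplies the ray of angle `x` by `exp (w x)`. For a periodic `w`
it is the shear `ζ ↦ ζ + w ζ.im` in logarithmic coordinates. -/
noncomputable def twist (w : ℝ → ℂ) (z : ℂ) : ℂ := z * Complex.exp (w z.arg)

theorem twist_zero (w : ℝ → ℂ) : twist w 0 = 0 := zero_mul _

theorem twist_smul (w : ℝ → ℂ) {t : ℝ} (ht : 0 < t) (z : ℂ) :
    twist w (t • z) = t • twist w z := by
  rw [twist, twist, Complex.real_smul, Complex.real_smul, Complex.arg_real_mul _ ht, mul_assoc]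

theorem norm_twist (w : ℝ → ℂ) (z : ℂ) : ‖twist w z‖ = Real.exp (w z.arg).re * ‖z‖ := by
  rw [twist, Complex.norm_mul, Complex.norm_exp, mul_comm]

theorem twist_eq_zero_iff {w : ℝ → ℂ} {z : ℂ} : twist w z = 0 ↔ z = 0 :=
  mul_eq_zero_iff_right (Complex.exp_ne_zero _)

theorem norm_unitInterval_mul_le (t : I) {z : ℂ} {C : ℝ} (hz : ‖z‖ ≤ C) :
    ‖((t : ℝ) : ℂ) * z‖ ≤ C := by
  rw [Complex.norm_mul, Complex.norm_real, Real.norm_of_nonneg t.2.1]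
  exact (mul_le_of_le_one_left (norm_nonneg z) t.2.2).trans hz

theorem strictMono_add_unitInterval_mul {v : ℝ → ℝ} (hv : StrictMono fun x => x + v x) (t : I) :
    StrictMono fun x => x + t * v x := by
  intro x y hxy
  have t_nonneg : 0 ≤ (t : ℝ) := t.2.1
  have symm_nonneg : 0 ≤ 1 - (t : ℝ) := sub_nonneg.2 t.2.2
  have convex (x : ℝ) : x + t * v x = (1 - t) * x + t * (x + v x) := by ring
  simp only [convex]
  rcases t_nonneg.eq_or_lt with t_eq_zero | t_pos
  · simpa only [← t_eq_zero, sub_zero, one_mul, zero_mul, add_zero] using hxy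
  · exact add_lt_add_of_le_of_lt (mul_le_mul_of_nonneg_left hxy.le symm_nonneg)
      (mul_lt_mul_of_pos_left (hv hxy) t_pos)

theorem norm_twist_le {w : ℝ → ℂ} {C : ℝ} (hC : ∀ x, ‖w x‖ ≤ C) (z : ℂ) :
    ‖twist w z‖ ≤ Real.exp C * ‖z‖ := by
  rw [norm_twist]
  gcongr
  exact (Complex.re_le_norm _).trans (hC _)

theorem le_norm_twist {w : ℝ → ℂ} {C : ℝ} (hC : ∀ x, ‖w x‖ ≤ C) (z : ℂ) :
    Real.exp (-C) * ‖z‖ ≤ ‖twist w z‖ := by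
  rw [norm_twist]
  gcongr
  exact (abs_le.1 ((Complex.abs_re_le_norm _).trans (hC _))).1

section Periodic

variable {w : ℝ → ℂ} (hw : Function.Periodic w (2 * Real.pi))
include hw

theorem twist_exp (ζ : ℂ) : twist w (Complex.exp ζ) = Complex.exp (ζ + w ζ.im) := by
  rw [twist, Complex.arg_exp, toIocMod, hw.sub_zsmul_eq, Complex.exp_add]

theorem twist_injective (hmono : StrictMono fun x => x + (w x).im) :
    Function.Injective (twist w) := by
  intro z₁ z₂ h
  rcases eq_or_ne z₁ 0 with rfl | hz₁
  · exact (twist_eq_zero_iff.1 (h.symm.trans (twist_zero w))).symm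
  have hz₂ : z₂ ≠ 0 := fun hz₂ => hz₁ (twist_eq_zero_iff.1 (h.trans (twist_eq_zero_iff.2 hz₂)))
  obtain ⟨ζ, rfl⟩ : ∃ ζ, Complex.exp ζ = z₁ := ⟨_, Complex.exp_log hz₁⟩
  obtain ⟨η, rfl⟩ : ∃ η, Complex.exp η = z₂ := ⟨_, Complex.exp_log hz₂⟩
  rw [twist_exp hw, twist_exp hw] at h
  obtain ⟨n, hn⟩ := Complex.exp_eq_exp_iff_exists_int.1 h
  have im_add : (η + n * (2 * Real.pi * Complex.I)).im = η.im + n * (2 * Real.pi) := by simp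
  have shears_eq : ζ + w ζ.im = (η + n * (2 * Real.pi * Complex.I)) +
      w (η + n * (2 * Real.pi * Complex.I)).im := by
    rw [im_add, hw.int_mul n, hn]
    ring
  have im_eq : ζ.im = (η + n * (2 * Real.pi * Complex.I)).im :=
    hmono.injective (by simpa only [Complex.add_im] using congrArg Complex.im shears_eq)
  rw [im_eq] at shears_eq
  exact Complex.exp_eq_exp_iff_exists_int.2 ⟨n, add_right_cancel shears_eq⟩

variable (hc : Continuous w)
include hc

theorem exists_norm_le_of_periodic : ∃ C, ∀ x, ‖w x‖ ≤ C := by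
  obtain ⟨C, hC⟩ := (hw.compact_of_continuous Real.two_pi_pos.ne' hc).isBounded.exists_norm_le
  exact ⟨C, fun x => hC _ ⟨x, rfl⟩⟩

theorem twist_surjective : Function.Surjective (twist w) := by
  intro z
  rcases eq_or_ne z 0 with rfl | hz
  · exact ⟨0, twist_zero w⟩
  obtain ⟨η, rfl⟩ : ∃ η, Complex.exp η = z := ⟨_, Complex.exp_log hz⟩
  obtain ⟨C, hC⟩ := exists_norm_le_of_periodic hw hc
  have im_bound (x : ℝ) := abs_le.1 ((Complex.abs_im_le_norm (w x)).trans (hC x))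
  have surjective : Function.Surjective fun x => x + (w x).im := by
    refine Continuous.surjective (by fun_prop) ?_ ?_
    · exact tendsto_atTop_add_right_of_le _ (-C) tendsto_id fun x => (im_bound x).1
    · exact tendsto_atBot_add_right_of_ge _ C tendsto_id fun x => (im_bound x).2
  obtain ⟨x, hx⟩ := surjective η.im
  have im_sub : (η - w x).im = x := by rw [Complex.sub_im, ← hx, add_sub_cancel_right]
  exact ⟨Complex.exp (η - w x), by rw [twist_exp hw, im_sub, sub_add_cancel]⟩

theorem continuousAt_periodic_arg {z : ℂ} (hz : z ≠ 0) :
    ContinuousAt (fun z => w (Complex.arg z)) z := by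
  have lift_continuous : Continuous (hw.lift : Real.Angle → ℂ) := continuous_quot_lift _ hc
  exact lift_continuous.continuousAt.comp (Complex.continuousAt_arg_coe_angle hz)

theorem continuous_twist :
    Continuous fun x : I × ℂ => twist (fun y => (x.1 : ℝ) * w y) x.2 := by
  refine continuous_iff_continuousAt.2 fun ⟨t, z⟩ => ?_
  rcases eq_or_ne z 0 with rfl | hz
  · obtain ⟨C, hC⟩ := exists_norm_le_of_periodic hw hc
    rw [ContinuousAt, twist_zero]
    refine squeeze_zero_norm
      (fun x => norm_twist_le (fun y => norm_unitInterval_mul_le x.1 (hC y)) x.2) ?_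
    have h : Continuous fun x : I × ℂ => Real.exp C * ‖x.2‖ := by fun_prop
    simpa using h.tendsto (t, 0)
  · have h : ContinuousAt (fun x : I × ℂ => w x.2.arg) (t, z) :=
      ContinuousAt.comp (f := Prod.snd) (g := fun z : ℂ => w z.arg)
        (continuousAt_periodic_arg hw hc hz) continuousAt_snd
    have scalar : Continuous fun x : I × ℂ => ((x.1 : ℝ) : ℂ) :=
      Complex.continuous_ofReal.comp (continuous_subtype_val.comp continuous_fst)
    exact continuousAt_snd.mul (scalar.continuousAt.mul h).cexp

theorem exists_homeomorph_twist (hmono : StrictMono fun x => x + (w x).im) :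
    ∃ φ : ℂ ≃ₜ ℂ, IsotopicToId φ ∧ ⇑φ = twist w := by
  obtain ⟨C, hC⟩ := exists_norm_le_of_periodic hw hc
  have bijective (t : I) : Function.Bijective (twist fun x => (t : ℝ) * w x) := by
    have periodic : Function.Periodic (fun x => ((t : ℝ) : ℂ) * w x) (2 * Real.pi) :=
      fun x => congrArg (((t : ℝ) : ℂ) * ·) (hw x)
    refine ⟨twist_injective periodic ?_, twist_surjective periodic (hc.const_mul _)⟩
    simpa only [Complex.im_ofReal_mul] using strictMono_add_unitInterval_mul hmono t
  let H := PlaneIsotopy.ofBijective (fun t => twist fun x => (t : ℝ) * w x)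
    (continuous_twist hw hc) bijective (fun z => by simp [twist]) (Real.exp_pos (-C))
    fun t => le_norm_twist fun x => norm_unitInterval_mul_le t (hC x)
  refine ⟨H.final, H.final_isotopicToId, funext fun z => ?_⟩
  change twist (fun x => ((1 : I) : ℝ) * w x) z = twist w z
  simp only [Icc.coe_one, Complex.ofReal_one, one_mul]

end Periodic

theorem exp_eq_smul_exp_im (ζ : ℂ) :
    Complex.exp ζ = Real.exp ζ.re • Complex.exp (ζ.im * Complex.I) := by
  rw [Complex.real_smul, Complex.ofReal_exp, ← Complex.exp_add, Complex.re_add_im]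

namespace PinnedBody

theorem gauge_exp (X : PinnedBody) (ζ : ℂ) :
    X.gauge (Complex.exp ζ) = Real.exp ζ.re * X.gauge (Complex.exp (ζ.im * Complex.I)) := by
  rw [exp_eq_smul_exp_im, X.gauge_smul _ _ (Real.exp_nonneg _)]

theorem exp_mem_spokes_iff_im (X : PinnedBody) (ζ : ℂ) :
    Complex.exp ζ ∈ X.spokes ↔ Complex.exp (ζ.im * Complex.I) ∈ X.spokes := by
  rw [exp_eq_smul_exp_im, X.smul_mem_spokes (Real.exp_pos _)]

theorem gauge_exp_pos (X : PinnedBody) (ζ : ℂ) : 0 < X.gauge (Complex.exp ζ) :=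
  X.gauge_pos _ (Complex.exp_ne_zero ζ)

/-- The shear of logarithmic coordinates that takes the direction `x` to the direction `θ x` and
the gauge of `X` to the gauge of `Y`. -/
noncomputable def shear (X Y : PinnedBody) (θ : ℝ → ℝ) (x : ℝ) : ℂ :=
  Real.log (X.gauge (Complex.exp (x * Complex.I)) / Y.gauge (Complex.exp (θ x * Complex.I))) +
    (θ x - x : ℝ) * Complex.I

section shear

variable (X Y : PinnedBody) {θ : ℝ → ℝ}

theorem shear_re (x : ℝ) : (shear X Y θ x).re =
    Real.log (X.gauge (Complex.exp (x * Complex.I)) /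
      Y.gauge (Complex.exp (θ x * Complex.I))) := by
  rw [shear, Complex.add_re, Complex.ofReal_re, Complex.re_ofReal_mul, Complex.I_re, mul_zero,
    add_zero]

theorem shear_im (x : ℝ) : (shear X Y θ x).im = θ x - x := by
  rw [shear, Complex.add_im, Complex.ofReal_im, Complex.im_ofReal_mul, Complex.I_im, mul_one,
    zero_add]

theorem continuous_shear (hθ : Continuous θ) : Continuous (shear X Y θ) := by
  have hX := X.continuous_gauge
  have hY := Y.continuous_gauge
  unfold shear
  refine (Complex.continuous_ofReal.comp (Continuous.log ?_ fun x => ?_)).add ?_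
  · exact Continuous.div (by fun_prop) (by fun_prop) fun x => (Y.gauge_exp_pos _).ne'
  · exact (div_pos (X.gauge_exp_pos _) (Y.gauge_exp_pos _)).ne'
  · fun_prop

theorem shear_periodic (hθ : ∀ x, θ (x + 2 * Real.pi) = θ x + 2 * Real.pi) :
    Function.Periodic (shear X Y θ) (2 * Real.pi) := by
  intro x
  have exp_periodic (y : ℝ) :
      Complex.exp ((y + 2 * Real.pi : ℝ) * Complex.I) = Complex.exp (y * Complex.I) := by
    push_cast
    exact Complex.exp_mul_I_periodic y
  rw [shear, shear, hθ, exp_periodic, exp_periodic, add_sub_add_right_eq_sub]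

theorem gauge_exp_add_shear (ζ : ℂ) :
    Y.gauge (Complex.exp (ζ + shear X Y θ ζ.im)) = X.gauge (Complex.exp ζ) := by
  have hX := X.gauge_exp_pos (ζ.im * Complex.I)
  have hY := Y.gauge_exp_pos (θ ζ.im * Complex.I)
  rw [Y.gauge_exp, X.gauge_exp ζ, Complex.add_re, Complex.add_im, shear_re, shear_im,
    add_sub_cancel, Real.exp_add, Real.exp_log (div_pos hX hY), mul_assoc,
    div_mul_cancel₀ _ hY.ne']

theorem exp_add_shear_mem_spokes
    (h : ∀ x : ℝ, Complex.exp (θ x * Complex.I) ∈ Y.spokes ↔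
      Complex.exp (x * Complex.I) ∈ X.spokes) (ζ : ℂ) :
    Complex.exp (ζ + shear X Y θ ζ.im) ∈ Y.spokes ↔ Complex.exp ζ ∈ X.spokes := by
  rw [Y.exp_mem_spokes_iff_im, X.exp_mem_spokes_iff_im, Complex.add_im, shear_im,
    add_sub_cancel, h]

end shear

end PinnedBody

theorem BodyIso.nonempty_of_card_eq {X Y : PinnedBody} (h : Nat.card X.Pin = Nat.card Y.Pin) :
    Nonempty (BodyIso X Y) := by
  obtain ⟨θ, θ_add, θ_spokes⟩ := PinnedBody.exists_matching X Y h
  have periodic := PinnedBody.shear_periodic X Y θ_add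
  have strictMono : StrictMono fun x => x + (PinnedBody.shear X Y θ x).im := by
    simpa only [PinnedBody.shear_im, add_sub_cancel] using θ.strictMono
  obtain ⟨φ, isotopic, hφ⟩ :=
    exists_homeomorph_twist periodic (PinnedBody.continuous_shear X Y θ.continuous) strictMono
  refine ⟨⟨φ, isotopic, fun t z ht => ?_, fun z => ?_, fun z => ?_⟩⟩
  · rw [hφ, twist_smul _ ht]
  · rw [hφ]
    rcases eq_or_ne z 0 with rfl | hz
    · rw [twist_zero, X.gauge_zero, Y.gauge_zero]
    · rw [← Complex.exp_log hz, twist_exp periodic, PinnedBody.gauge_exp_add_shear]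
  · rw [hφ]
    rcases eq_or_ne z 0 with rfl | hz
    · rw [twist_zero]
      exact iff_of_false Y.zero_notMem_spokes X.zero_notMem_spokes
    · rw [← Complex.exp_log hz, twist_exp periodic,
        PinnedBody.exp_add_shear_mem_spokes X Y θ_spokes]

/-! ### Multicategories of diagrams -/

theorem diagrams_equivalent {O O' : Type} (B : O → PinnedBody) (C : O' → PinnedBody)
    (hBC : ∀ a, ∃ b, Nat.card (B a).Pin = Nat.card (C b).Pin)
    (hCB : ∀ b, ∃ a, Nat.card (B a).Pin = Nat.card (C b).Pin) :
    (diagrams B).Equivalent (diagrams C) := by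
  refine pullback_equivalent (M := diagrams (Sum.elim B C)) (f := Sum.inl) (g := Sum.inr)
    (fun a => ?_) (fun b => ?_)
  · obtain ⟨b, hb⟩ := hBC a
    exact ⟨b, (BodyIso.nonempty_of_card_eq hb).map BodyIso.objIso⟩
  · obtain ⟨a, ha⟩ := hCB b
    exact ⟨a, (BodyIso.nonempty_of_card_eq ha.symm).map BodyIso.objIso⟩

theorem card_pin_disk (n : ℕ) : Nat.card (disk n).Pin = n := Nat.card_fin n

theorem card_pin_box (p : ℕ × ℕ) : Nat.card (box p).Pin = p.1 + p.2 := by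
  change Nat.card (Fin p.1 ⊕ Fin p.2) = p.1 + p.2
  rw [Nat.card_sum, Nat.card_fin, Nat.card_fin]

theorem disk_equivalent_box : diskDiagrams.Equivalent boxDiagrams := by
  refine diagrams_equivalent disk box (fun n => ⟨(n, 0), ?_⟩) fun p => ⟨p.1 + p.2, ?_⟩
  all_goals simp only [card_pin_disk, card_pin_box, add_zero]

theorem evenDisk_equivalent_evenBox : evenDiskDiagrams.Equivalent evenBoxDiagrams := by
  refine diagrams_equivalent (fun n : {n : ℕ // Even n} => disk n.1)
    (fun p : {p : ℕ × ℕ // Even (p.1 + p.2)} => box p.1)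
    (fun n => ⟨⟨(n.1, 0), n.2⟩, ?_⟩) fun p => ⟨⟨p.1.1 + p.1.2, p.2⟩, ?_⟩
  all_goals simp only [card_pin_disk, card_pin_box, add_zero]

theorem evenBox_equivalent_diagonal : evenBoxDiagrams.Equivalent diagonalDiagrams := by
  refine diagrams_equivalent (fun p : {p : ℕ × ℕ // Even (p.1 + p.2)} => box p.1)
    (fun p : {p : {p : ℕ × ℕ // Even (p.1 + p.2)} // p.1.1 = p.1.2} => box p.1.1)
    (fun ⟨p, hp⟩ => ?_) fun p => ⟨p.1, rfl⟩
  obtain ⟨m, hm⟩ := hp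
  exact ⟨⟨⟨(m, m), m, rfl⟩, rfl⟩, by simp only [card_pin_box, hm]⟩

theorem evenDisk_equivalent_diagonal : evenDiskDiagrams.Equivalent diagonalDiagrams := by
  refine diagrams_equivalent (fun n : {n : ℕ // Even n} => disk n.1)
    (fun p : {p : {p : ℕ × ℕ // Even (p.1 + p.2)} // p.1.1 = p.1.2} => box p.1.1)
    (fun ⟨n, hn⟩ => ?_) fun p => ⟨⟨p.1.1.1 + p.1.1.2, p.1.2⟩, ?_⟩
  · obtain ⟨m, hm⟩ := hn
    exact ⟨⟨⟨(m, m), m, rfl⟩, rfl⟩, by simp only [card_pin_disk, card_pin_box, hm]⟩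
  · simp only [card_pin_disk, card_pin_box]

end PlanarDiagrams

theorem mainTheorem6 :
    diskDiagrams.Equivalent boxDiagrams ∧
    (evenDiskDiagrams.Equivalent evenBoxDiagrams ∧
      evenBoxDiagrams.Equivalent diagonalDiagrams ∧
      evenDiskDiagrams.Equivalent diagonalDiagrams) ∧
    ∀ (k : Type u) [Field k],
      Nonempty (MRep.{u, 0, 0, w} k diskDiagrams ≌ MRep.{u, 0, 0, w} k boxDiagrams) ∧
      Nonempty (MRep.{u, 0, 0, w} k evenDiskDiagrams ≌ MRep.{u, 0, 0, w} k evenBoxDiagrams) ∧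
      Nonempty (MRep.{u, 0, 0, w} k evenBoxDiagrams ≌ MRep.{u, 0, 0, w} k diagonalDiagrams) ∧
      Nonempty (MRep.{u, 0, 0, w} k evenDiskDiagrams ≌ MRep.{u, 0, 0, w} k diagonalDiagrams) :=
  ⟨disk_equivalent_box,
    ⟨evenDisk_equivalent_evenBox, evenBox_equivalent_diagonal, evenDisk_equivalent_diagonal⟩,
    fun _ _ => ⟨disk_equivalent_box.mRep, evenDisk_equivalent_evenBox.mRep,
      evenBox_equivalent_diagonal.mRep, evenDisk_equivalent_diagonal.mRep⟩⟩
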